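/- An oriented $n$-component virtual link $L=K_1\cup\dots\cup K_n$ (with ordered components) is an oriented virtual link diagram up to generalized Reidemeister moves; equivalently, a Gauss diagram on $n$ ordered oriented circles $G_1,\dots,G_n$, up to Reidemeister moves I, II, III with all orientations. In a Gauss diagram each real crossing is a chord, directed from the overcrossing to the undercrossing and carrying the sign of the crossing; local moves may be applied to any pairwise disjoint arcs of the circles. **Moves.** A *virtualized $\Delta$-move* ($v\Delta$-move) makes virtual the three real crossings of three strands $S_0,S_1,S_2$ that bound a triangle, where $S_j$ passes over $S_{j+1}$ (indices mod $3$), or is the inverse of this; all orientations and both mirror images are allowed. On Gauss diagrams: let $\varepsilon\in\{\pm1\}$, and let $s_j=+1$ or $-1$ according to whether $S_j$ is directed along or against the cyclic order $S_0,S_1,S_2$ of the sides of the triangle. The move deletes (or adds) three chords $c_j$ from $S_j$ to $S_{j+1}$ of signs $\varepsilon s_js_{j+1}$, where the endpoints on $S_j$ are consecutive, and along $S_j$ one meets the terminal endpoint of $c_{j-1}$ and then the initial endpoint of $c_j$ if $s_j=1$, and the reverse if $s_j=-1$. The move is a *$v\Delta^\wedge$-move* if $s_0,s_1,s_2$ are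 not all equal, that is, if the strands are not coherently directed around the triangle. A *virtualized $\sharp$-move* ($v\sharp$-move) makes virtual the four real crossings of two parallel strands of the same direction that pass over two parallel strands of the same direction, or is the inverse of this. On Gauss diagrams it deletes (or adds) four chords $c_{ij}$ ($i,j\in\{0,1\}$), all of the same sign, where $c_{i0},c_{i1}$ have consecutive initial endpoints, in this order, on the $i$-th overstrand, and $c_{0j},c_{1j}$ have consecutive terminal endpoints, in this order, on the $j$-th understrand. For $X\in\{v\Delta,v\Delta^\wedge,v\sharp\}$, two links are *$X$-equivalent* if their diagrams are related by a finite sequence of $X$-moves, up to generalized Reidemeister moves. **Parity.** For $1\le i\le n$, the *$i$-th parity* $p_i(L)\in\mathbb Z/2\mathbb Z$ is the number, modulo $2$, of real crossings between the $i$-th component and the other components in a diagram of $L$ (an invariant of $L$). Equivalently, $p_i(L)\equiv\sum_{j\ne i}\bigl(\mathrm{Lk}(K_i,K_j)+\mathrm{Lk}(K_j,K_i)\bigr)\pmod 2$, where $\mathrm{Lk}(K_i,K_j)$ is the sum of the signs of the chords directed from $G_i$ to $G_j$. **Theorem.** Let $n\ge2$, and let $L$ and $L'$ be oriented $n$-component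 virtual links with ordered components. Then the following are equivalent: 1. $L$ and $L'$ are $v\Delta$-equivalent; 2. $L$ and $L'$ are $v\Delta^\wedge$-equivalent; 3. $L$ and $L'$ are $v\sharp$-equivalent; 4. $p_i(L)=p_i(L')$ for all $i=1,\dots,n$. -/

import Mathlib

/-! Oriented virtual links with ordered components, presented by Gauss diagrams. -/

/-- An endpoint of a chord of a Gauss diagram: the name of the chord, whether the endpoint is the
initial one (`isOver = true`, the overcrossing) or the terminal one (`isOver = false`, the
undercrossing), and the sign of the chord. -/
@[ext] structure Endpoint where
  chord : ℕ
  isOver : Bool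
  sign : ℤˣ
deriving DecidableEq

namespace Endpoint

/-- The other endpoint of the same chord. -/
def opposite (e : Endpoint) : Endpoint := ⟨e.chord, !e.isOver, e.sign⟩

/-- Renaming of chords. -/
def rename (σ : Equiv.Perm ℕ) (e : Endpoint) : Endpoint := ⟨σ e.chord, e.isOver, e.sign⟩

end Endpoint

/-- The initial endpoint (overcrossing) of the chord `c` of sign `ε`. -/
def overEnd (c : ℕ) (ε : ℤˣ) : Endpoint := ⟨c, true, ε⟩

/-- The terminal endpoint (undercrossing) of the chord `c` of sign `ε`. -/
def underEnd (c : ℕ) (ε : ℤˣ) : Endpoint := ⟨c, false, ε⟩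

/-- A Gauss diagram on `n` ordered oriented circles. `circle i` lists the endpoints of chords met
when travelling once along the `i`-th circle in its direction from some base point. Every chord
has one initial and one terminal endpoint and one sign. -/
structure GaussDiagram (n : ℕ) where
  circle : Fin n → List Endpoint
  nodup : ∀ i, (circle i).Nodup
  disjoint : ∀ i j, i ≠ j → (circle i).Disjoint (circle j)
  opposite_mem : ∀ i, ∀ e ∈ circle i, ∃ j, e.opposite ∈ circle j
  sign_eq : ∀ i j, ∀ e ∈ circle i, ∀ f ∈ circle j, e.chord = f.chord → e.sign = f.sign

namespace GaussDiagram

variable {n : ℕ}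

/-- `D` and `D'` are the same Gauss diagram up to the names of the chords and the choice of a
base point on each circle. -/
def Iso (D D' : GaussDiagram n) : Prop :=
  ∃ σ : Equiv.Perm ℕ, ∀ i, ((D.circle i).map (Endpoint.rename σ)).IsRotated (D'.circle i)

/-- A union of `n` circles from which `k` disjoint oriented arcs (the strands taking part in a
local move) have been cut out: each circle is a word in endpoints and in placeholders for these
arcs. -/
abbrev Context (n k : ℕ) := Fin n → List (Endpoint ⊕ Fin k)

/-- Each of the `k` arcs occurs exactly once. -/
def Context.Valid {k : ℕ} (C : Context n k) : Prop :=
  ∀ s : Fin k, ∑ i, (C i).count (Sum.inr s) = 1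

/-- Insert the words `w s`, `s : Fin k`, at the places of the arcs. -/
def Context.fill {k : ℕ} (C : Context n k) (w : Fin k → List Endpoint) (i : Fin n) :
    List Endpoint :=
  (C i).flatMap (Sum.elim (fun e => [e]) w)

/-- `D'` is obtained from `D` by a local replacement on `k` strands: the endpoints met along the
`s`-th strand are those in `v s` for `D` and those in `w s` for `D'`, and the diagrams agree
elsewhere. -/
def LocalMove {k : ℕ} (v w : Fin k → List Endpoint) (D D' : GaussDiagram n) : Prop :=
  ∃ C : Context n k, C.Valid ∧ D.circle = C.fill v ∧ D'.circle = C.fill w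

end GaussDiagram

/-- A word along a strand, read in the direction `s` of the strand. -/
def directed (s : ℤˣ) (w : List Endpoint) : List Endpoint := if s = 1 then w else w.reverse

/-- The three strands of a third Reidemeister move: strand `0` (top) runs over strands `1` and `2`
in the chords `a` and `b`, and strand `1` (middle) runs over strand `2` (bottom) in the chord `c`.
The three strands bound a triangle whose sides, in the cyclic order `0, 1, 2`, follow one another
counterclockwise (`η = 1`) or clockwise (`η = -1`); `s j = 1` if the strand `j` is
directed along that cyclic order, and `s j = -1` if against it. -/
def triangle3 (a b c : ℕ) (η : ℤˣ) (s : Fin 3 → ℤˣ) : Fin 3 → List Endpoint :=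
  ![directed (s 0) [overEnd b (-(η * s 0 * s 2)), overEnd a (η * s 0 * s 1)],
    directed (s 1) [underEnd a (η * s 0 * s 1), overEnd c (η * s 1 * s 2)],
    directed (s 2) [underEnd c (η * s 1 * s 2), underEnd b (-(η * s 0 * s 2))]]

/-- The Reidemeister moves I, II and III with all orientations, on Gauss diagrams. -/
inductive ReidemeisterMove {n : ℕ} : GaussDiagram n → GaussDiagram n → Prop
  /-- A chord whose endpoints are consecutive is deleted. -/
  | one (c : ℕ) (o : Bool) (ε : ℤˣ) (D D' : GaussDiagram n) :
      GaussDiagram.LocalMove ![[⟨c, o, ε⟩, ⟨c, !o, ε⟩]] ![[]] D D' → ReidemeisterMove D D'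
  /-- Two chords of opposite signs with consecutive initial endpoints and consecutive terminal
  endpoints are deleted; the two strands have the same direction. -/
  | two_parallel (c d : ℕ) (ε : ℤˣ) (D D' : GaussDiagram n) :
      GaussDiagram.LocalMove ![[overEnd c ε, overEnd d (-ε)], [underEnd c ε, underEnd d (-ε)]]
        ![[], []] D D' → ReidemeisterMove D D'
  /-- The same with strands of opposite directions. -/
  | two_antiparallel (c d : ℕ) (ε : ℤˣ) (D D' : GaussDiagram n) :
      GaussDiagram.LocalMove ![[overEnd c ε, overEnd d (-ε)], [underEnd d (-ε), underEnd c ε]]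
        ![[], []] D D' → ReidemeisterMove D D'
  /-- A strand is moved across the crossing of two others: the order of the two crossings is
  reversed on each of the three strands. -/
  | three (a b c : ℕ) (η : ℤˣ) (s : Fin 3 → ℤˣ) (D D' : GaussDiagram n) :
      GaussDiagram.LocalMove (triangle3 a b c η s) (fun j => (triangle3 a b c η s j).reverse) D D' →
        ReidemeisterMove D D'

/-- The real crossings deleted by a virtualized Delta move: three strands bound a triangle, and
strand `j` runs over strand `j + 1` (indices modulo `3`) in the chord `c j`. Here `s j = 1` or
`-1` according to whether the strand `j` is directed along or against the cyclic order `0, 1, 2`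
of the sides of the triangle, and `ε` is the common sign of the crossings for `s = 1`. -/
def deltaCrossings (c : Fin 3 → ℕ) (ε : ℤˣ) (s : Fin 3 → ℤˣ) : Fin 3 → List Endpoint := fun j =>
  directed (s j)
    [underEnd (c (j - 1)) (ε * s (j - 1) * s j), overEnd (c j) (ε * s j * s (j + 1))]

/-- A virtualized Delta move: the three real crossings of the triangle become virtual, that is,
the three chords are deleted. All eight oriented types are included. -/
def VDelta {n : ℕ} (D D' : GaussDiagram n) : Prop :=
  ∃ (c : Fin 3 → ℕ) (ε : ℤˣ) (s : Fin 3 → ℤˣ),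
    GaussDiagram.LocalMove (deltaCrossings c ε s) (fun _ => []) D D'

/-- A virtualized Delta move of wedge type: the three strands are not coherently directed
around the triangle (four of the eight oriented types). -/
def VDeltaWedge {n : ℕ} (D D' : GaussDiagram n) : Prop :=
  ∃ (c : Fin 3 → ℕ) (ε : ℤˣ) (s : Fin 3 → ℤˣ), (∃ j k, s j ≠ s k) ∧
    GaussDiagram.LocalMove (deltaCrossings c ε s) (fun _ => []) D D'

/-- The real crossings deleted by a virtualized sharp move: two parallel strands `0, 1` of the same
direction run over two parallel strands `2, 3` of the same direction; the chord `c i j` from the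
`i`-th overstrand to the `j`-th understrand has sign `ε`. -/
def sharpCrossings (c : Fin 2 → Fin 2 → ℕ) (ε : ℤˣ) : Fin 4 → List Endpoint :=
  ![[overEnd (c 0 0) ε, overEnd (c 0 1) ε],
    [overEnd (c 1 0) ε, overEnd (c 1 1) ε],
    [underEnd (c 0 0) ε, underEnd (c 1 0) ε],
    [underEnd (c 0 1) ε, underEnd (c 1 1) ε]]

/-- A virtualized sharp move: the four real crossings become virtual, that is, the four chords are
deleted. The two oriented types are distinguished by the sign. -/
def VSharp {n : ℕ} (D D' : GaussDiagram n) : Prop :=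
  ∃ (c : Fin 2 → Fin 2 → ℕ) (ε : ℤˣ),
    GaussDiagram.LocalMove (sharpCrossings c ε) (fun _ => []) D D'

/-- Two Gauss diagrams present the same virtual link if they are related by a finite sequence of
isomorphisms, Reidemeister moves and their inverses. -/
def GaussDiagram.reidemeisterSetoid (n : ℕ) : Setoid (GaussDiagram n) :=
  Relation.EqvGen.setoid fun D D' => D.Iso D' ∨ ReidemeisterMove D D'

/-- Oriented virtual links with `n` ordered components. -/
def VirtualLink (n : ℕ) : Type := Quotient (GaussDiagram.reidemeisterSetoid n)

/-- The virtual link presented by a Gauss diagram. -/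
def GaussDiagram.toLink {n : ℕ} (D : GaussDiagram n) : VirtualLink n :=
  Quotient.mk (GaussDiagram.reidemeisterSetoid n) D

/-- For a local move `X` on diagrams: `L` and `L'` are related by a finite sequence of `X`-moves
and their inverses, up to Reidemeister moves. -/
def MoveEquivalent {n : ℕ} (X : GaussDiagram n → GaussDiagram n → Prop) (L L' : VirtualLink n) :
    Prop :=
  Relation.EqvGen (fun K K' => ∃ D D', D.toLink = K ∧ D'.toLink = K' ∧ X D D') L L'

namespace GaussDiagram

variable {n : ℕ}

/-- The number, modulo `2`, of the endpoints on the `i`-th circle whose chord joins it to another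
circle, that is, of the real crossings between the `i`-th component and the other components. -/
def parity (D : GaussDiagram n) (i : Fin n) : ZMod 2 :=
  (((D.circle i).filter fun e => decide (e.opposite ∉ D.circle i)).length : ZMod 2)

/-- Chords with both endpoints on the `i`-th circle do not matter modulo `2`. -/
theorem parity_eq_length (D : GaussDiagram n) (i : Fin n) :
    D.parity i = ((D.circle i).length : ZMod 2) := by
  have h0 : (((D.circle i).filter fun e => !decide (e.opposite ∉ D.circle i)).length : ZMod 2)
      = 0 := by
    have hn := (D.nodup i).filter (fun e => !decide (e.opposite ∉ D.circle i))
    rw [← List.toFinset_card_of_nodup hn, Finset.card_eq_sum_ones, Nat.cast_sum]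
    refine Finset.sum_involution (fun e _ => e.opposite) ?_ ?_ ?_ ?_
    · intro e _
      decide
    · intro e _ _ h
      have := congrArg Endpoint.isOver h
      simp [Endpoint.opposite] at this
    · intro e he
      simp only [List.mem_toFinset, List.mem_filter, Bool.not_eq_true', decide_eq_false_iff_not,
        not_not] at he ⊢
      simpa [Endpoint.opposite, and_comm] using he
    · intro e _
      simp [Endpoint.opposite]
  have h1 := List.length_eq_length_filter_add (l := D.circle i)
    (fun e => decide (e.opposite ∉ D.circle i))
  rw [h1, Nat.cast_add, h0, add_zero]
  rfl

theorem length_fill {k : ℕ} (C : Context n k) (v w : Fin k → List Endpoint)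
    (h : ∀ s, ((v s).length : ZMod 2) = (w s).length) (i : Fin n) :
    ((C.fill v i).length : ZMod 2) = (C.fill w i).length := by
  unfold Context.fill
  induction C i with
  | nil => rfl
  | cons x l ih =>
    rcases x with e | s
    · rw [List.flatMap_cons, List.flatMap_cons, List.length_append, List.length_append,
        Nat.cast_add, Nat.cast_add, ih]
      rfl
    · rw [List.flatMap_cons, List.flatMap_cons, List.length_append, List.length_append,
        Nat.cast_add, Nat.cast_add, ih]
      exact congrArg (· + _) (h s)

theorem LocalMove.parity_eq {k : ℕ} {v w : Fin k → List Endpoint} {D D' : GaussDiagram n}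
    (hm : LocalMove v w D D') (h : ∀ s, ((v s).length : ZMod 2) = (w s).length) (i : Fin n) :
    D.parity i = D'.parity i := by
  obtain ⟨C, -, h1, h2⟩ := hm
  rw [parity_eq_length, parity_eq_length, h1, h2]
  exact length_fill C v w h i

theorem parity_eq_of_reidemeister {D D' : GaussDiagram n} (h : ReidemeisterMove D D')
    (i : Fin n) : D.parity i = D'.parity i := by
  cases h with
  | one c o ε _ _ h =>
    refine h.parity_eq (fun s => ?_) i
    fin_cases s; simp; rfl
  | two_parallel c d ε _ _ h =>
    refine h.parity_eq (fun s => ?_) i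
    fin_cases s <;> simp <;> rfl
  | two_antiparallel c d ε _ _ h =>
    refine h.parity_eq (fun s => ?_) i
    fin_cases s <;> simp <;> rfl
  | three a b c η s _ _ h =>
    refine h.parity_eq (fun j => ?_) i
    simp

theorem parity_eq_of_equiv {D D' : GaussDiagram n}
    (h : Relation.EqvGen (fun E E' => E.Iso E' ∨ ReidemeisterMove E E') D D') (i : Fin n) : D.parity i = D'.parity i := by
  induction h with
  | rel x y h =>
    rcases h with ⟨σ, hσ⟩ | h
    · rw [parity_eq_length, parity_eq_length, ← (hσ i).perm.length_eq, List.length_map]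
    · exact parity_eq_of_reidemeister h i
  | refl => rfl
  | symm _ _ _ ih => exact ih.symm
  | trans _ _ _ _ _ ih1 ih2 => exact ih1.trans ih2

end GaussDiagram

/-- The `i`-th parity of an oriented virtual link. -/
def VirtualLink.parity {n : ℕ} (L : VirtualLink n) (i : Fin n) : ZMod 2 :=
  Quotient.lift (fun D : GaussDiagram n => D.parity i)
    (fun _ _ h => GaussDiagram.parity_eq_of_equiv h i) L

/-! A $v\Delta$- or $v\sharp$-move deletes two endpoints on every strand, so it preserves the parity
of the number of endpoints on each circle. This is the $i$-th parity, because a chord with both ends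
on one circle contributes two. Every $v\Delta^\wedge$-move is a $v\Delta$-move, so the substance is
that $v\Delta^\wedge$-moves alone, and $v\sharp$-moves alone, connect any two diagrams with equal
parities.

The key is that both kinds of moves allow chords to be split (`Splits`): a chord joining two places
may be replaced by two chords from these places to adjacent points at any third place, with
arbitrary directions and signs. To see this, second Reidemeister moves complete the chord to a full
triangle or $\sharp$-pattern, which is then deleted; the cancelling partners of the added chords
survive, and superfluous ones disappear by first Reidemeister moves once strands are joined
(`splits_of_sharp`, `splits_of_delta`).

Splitting one chord in two ways shows that adjacent endpoints commute (`LocEq.swap_of_splits`,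
`rel_of_perm`), so only the multiset of chord types matters. In the commutative monoid of types up
to exchange (`chordCon`) the chords with both ends on one circle vanish, and splitting at a fixed
hub circle $z$ gives $[i,j,\varepsilon]=[i,z,1]+[j,z,1]$. Hence $2[i,z,1]=[i,i,1]=0$, and a diagram
with $\ell_i$ endpoints on circle $i$ has class $\sum_i\ell_i[i,z,1]$ (`mk_eq_sum`), which depends
only on the parities (`rel_of_parity`).

The local arguments concern words on $k$ strands that may be exchanged inside every diagram
(`LocEq`); concrete instances then become finite checks. -/

/-! ### Preliminaries on endpoints and renamings. -/

instance Sum.instLawfulBEq {α β : Type*} [BEq α] [BEq β] [LawfulBEq α] [LawfulBEq β] :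
    LawfulBEq (α ⊕ β) where
  eq_of_beq {x y} h := by
    rcases x with a | b <;> rcases y with c | d
    · exact congrArg _ (eq_of_beq (α := α) h)
    · cases h
    · cases h
    · exact congrArg _ (eq_of_beq (α := β) h)
  rfl {x} := by
    rcases x with a | b
    · exact beq_self_eq_true a
    · exact beq_self_eq_true b

/-- A finite injection between sets of natural numbers extends to a permutation. -/
theorem exists_perm_eqOn (A : Finset ℕ) (f : ℕ → ℕ) (hf : Set.InjOn f A) :
    ∃ σ : Equiv.Perm ℕ, ∀ x ∈ A, σ x = f x := by
  obtain ⟨σ, hσ⟩ := Cardinal.extend_function_of_lt (s := (A : Set ℕ))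
    ⟨fun x => f x, fun x y h => Subtype.ext (hf x.2 y.2 h)⟩
    (by rw [Cardinal.mk_nat]; exact Cardinal.lt_aleph0_of_finite _) ⟨Equiv.refl ℕ⟩
  exact ⟨σ, fun x hx => hσ ⟨x, hx⟩⟩

namespace Endpoint

@[simp] theorem opposite_opposite (e : Endpoint) : e.opposite.opposite = e := by
  simp [opposite]

theorem opposite_ne (e : Endpoint) : e.opposite ≠ e := by
  intro h
  have := congrArg Endpoint.isOver h
  simp [opposite] at this

@[simp] theorem chord_rename (σ : Equiv.Perm ℕ) (e : Endpoint) :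
    (e.rename σ).chord = σ e.chord := rfl

theorem eq_or_eq_opposite {e f : Endpoint} (hc : e.chord = f.chord) (hs : e.sign = f.sign) :
    e = f ∨ e = f.opposite := by
  rcases e with ⟨c, o, ε⟩
  rcases f with ⟨d, p, δ⟩
  simp only at hc hs
  subst hc hs
  cases o <;> cases p <;> simp [opposite]

theorem rename_injective (σ : Equiv.Perm ℕ) : Function.Injective (rename σ) := by
  intro e f h
  rw [Endpoint.ext_iff] at h ⊢
  simpa [rename] using h

theorem rename_eq_self {σ : Equiv.Perm ℕ} {e : Endpoint} (h : σ e.chord = e.chord) :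
    e.rename σ = e := by
  rw [Endpoint.ext_iff]
  exact ⟨h, rfl, rfl⟩

theorem rename_symm_rename (σ : Equiv.Perm ℕ) (e : Endpoint) :
    (e.rename σ).rename σ.symm = e := by
  simp [rename]

end Endpoint

/-! ### Gauss diagrams as families of words. -/

namespace GaussDiagram

variable {n k m : ℕ}

/-- The number of occurrences of an endpoint in a family of words. -/
def mult (W : Fin n → List Endpoint) (e : Endpoint) : ℕ := ∑ i, (W i).count e

/-- A family of words consists of the circles of a Gauss diagram. -/
def IsDiagram (W : Fin n → List Endpoint) : Prop := ∃ D : GaussDiagram n, D.circle = W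

/-- The names of chords in two families of words are different. -/
def Apart (W : Fin n → List Endpoint) (V : Fin m → List Endpoint) : Prop :=
  ∀ i, ∀ e ∈ W i, ∀ j, ∀ f ∈ V j, e.chord ≠ f.chord

instance (W : Fin n → List Endpoint) (V : Fin m → List Endpoint) : Decidable (Apart W V) := by
  unfold Apart; infer_instance

theorem mult_pos {W : Fin n → List Endpoint} {e : Endpoint} : 0 < mult W e ↔ ∃ i, e ∈ W i := by
  simp [mult, Finset.sum_pos_iff, List.count_pos_iff]

theorem mult_congr {W W' : Fin n → List Endpoint} (h : ∀ i, (W i).Perm (W' i)) :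
    mult W = mult W' := by
  funext e
  exact Finset.sum_congr rfl fun i _ => (h i).count_eq e

theorem apart_iff {W : Fin n → List Endpoint} {V : Fin m → List Endpoint} :
    Apart W V ↔ ∀ e f, 0 < mult W e → 0 < mult V f → e.chord ≠ f.chord := by
  simp only [mult_pos, Apart]
  constructor
  · rintro h e f ⟨i, hi⟩ ⟨j, hj⟩
    exact h i e hi j f hj
  · intro h i e hi j f hj
    exact h e f ⟨i, hi⟩ ⟨j, hj⟩

/-- Equality of diagrams with the same circles. -/
theorem circle_injective : Function.Injective (circle : GaussDiagram n → _) := by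
  rintro ⟨⟩ ⟨⟩ h
  cases h
  rfl

/-- Only total multiplicities occur on the right: the property ignores the order and the
distribution of endpoints on the circles, and it can be tested additively when words are glued. -/
theorem isDiagram_iff {W : Fin n → List Endpoint} :
    IsDiagram W ↔ (∀ e, mult W e ≤ 1) ∧ (∀ e, mult W e ≤ mult W e.opposite) ∧
      ∀ e f, 0 < mult W e → 0 < mult W f → e.chord = f.chord → e.sign = f.sign := by
  constructor
  · rintro ⟨D, rfl⟩
    have h1 : ∀ e, mult D.circle e ≤ 1 := by
      intro e
      by_cases h : ∃ i, e ∈ D.circle i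
      · obtain ⟨i, hi⟩ := h
        refine (Finset.sum_eq_single_of_mem i (Finset.mem_univ i) ?_).trans_le
          (List.nodup_iff_count_le_one.1 (D.nodup i) e)
        intro j _ hj
        exact List.count_eq_zero_of_not_mem fun h => D.disjoint i j hj.symm hi h
      · rw [← mult_pos] at h
        omega
    refine ⟨h1, fun e => ?_, ?_⟩
    · rcases Nat.eq_zero_or_pos (mult D.circle e) with h | h
      · omega
      · obtain ⟨i, hi⟩ := mult_pos.1 h
        have : 0 < mult D.circle e.opposite := mult_pos.2 (D.opposite_mem i e hi)
        have := h1 e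
        omega
    · simp only [mult_pos]
      rintro e f ⟨i, hi⟩ ⟨j, hj⟩
      exact D.sign_eq i j e hi f hj
  · rintro ⟨h1, h2, h3⟩
    refine ⟨⟨W, fun i => List.nodup_iff_count_le_one.2 fun e => ?_, ?_, ?_, ?_⟩, rfl⟩
    · exact (Finset.single_le_sum (f := fun i => (W i).count e) (fun _ _ => Nat.zero_le _)
        (Finset.mem_univ i)).trans (h1 e)
    · intro i j hij e hi hj
      have h := Finset.add_le_sum (f := fun i => (W i).count e) (fun _ _ => Nat.zero_le _)
        (Finset.mem_univ i) (Finset.mem_univ j) hij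
      have := h.trans (h1 e)
      have := List.count_pos_iff.2 hi
      have := List.count_pos_iff.2 hj
      omega
    · intro i e hi
      exact mult_pos.1 ((mult_pos.2 ⟨i, hi⟩).trans_le (h2 e))
    · intro i j e hi f hj
      exact h3 e f (mult_pos.2 ⟨i, hi⟩) (mult_pos.2 ⟨j, hj⟩)

theorem IsDiagram.congr {W W' : Fin n → List Endpoint} (h : ∀ i, (W i).Perm (W' i))
    (hW : IsDiagram W) : IsDiagram W' := by
  rw [isDiagram_iff, ← mult_congr h]
  exact isDiagram_iff.1 hW

theorem IsDiagram.mult_opposite {W : Fin n → List Endpoint} (h : IsDiagram W) (e : Endpoint) :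
    mult W e.opposite = mult W e := by
  have h2 := (isDiagram_iff.1 h).2.1
  refine le_antisymm ?_ (h2 e)
  simpa using h2 e.opposite

theorem IsDiagram.mult_eq_one {W : Fin n → List Endpoint} (h : IsDiagram W) {e : Endpoint}
    (he : ∃ i, e ∈ W i) : mult W e = 1 :=
  le_antisymm ((isDiagram_iff.1 h).1 e) (mult_pos.2 he)

theorem isDiagram_of_decide {W : Fin n → List Endpoint}
    (h : (∀ i, (W i).Nodup) ∧ (∀ i j, i ≠ j → ∀ e ∈ W i, e ∉ W j) ∧
      (∀ i, ∀ e ∈ W i, ∃ j, e.opposite ∈ W j) ∧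
      ∀ i j, ∀ e ∈ W i, ∀ f ∈ W j, e.chord = f.chord → e.sign = f.sign) : IsDiagram W :=
  ⟨⟨W, h.1, fun i j hij e he hf => h.2.1 i j hij e he hf, h.2.2.1, h.2.2.2⟩, rfl⟩

/-- Renaming of the chords of a family of words. -/
def renameWords (σ : Equiv.Perm ℕ) (W : Fin n → List Endpoint) : Fin n → List Endpoint :=
  fun i => (W i).map (Endpoint.rename σ)

theorem renameWords_symm (σ : Equiv.Perm ℕ) (W : Fin n → List Endpoint) :
    renameWords σ.symm (renameWords σ W) = W := by
  funext i
  simp [renameWords, Function.comp_def, Endpoint.rename_symm_rename]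

theorem renameWords_eq_self {σ : Equiv.Perm ℕ} {W : Fin n → List Endpoint}
    (h : ∀ i, ∀ e ∈ W i, σ e.chord = e.chord) : renameWords σ W = W := by
  funext i
  exact (List.map_congr_left (g := id) fun e he =>
    Endpoint.rename_eq_self (h i e he)).trans (List.map_id _)

/-- Renaming of the chords of a Gauss diagram. -/
def renameChords (σ : Equiv.Perm ℕ) (D : GaussDiagram n) : GaussDiagram n where
  circle := renameWords σ D.circle
  nodup i := (D.nodup i).map (Endpoint.rename_injective σ)
  disjoint i j hij := by
    intro e h h'
    obtain ⟨a, ha, rfl⟩ := List.mem_map.1 h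
    obtain ⟨b, hb, hab⟩ := List.mem_map.1 h'
    cases Endpoint.rename_injective σ hab
    exact D.disjoint i j hij ha hb
  opposite_mem i e h := by
    obtain ⟨a, ha, rfl⟩ := List.mem_map.1 h
    obtain ⟨j, hj⟩ := D.opposite_mem i a ha
    exact ⟨j, List.mem_map.2 ⟨_, hj, rfl⟩⟩
  sign_eq i j e h f h' hc := by
    obtain ⟨a, ha, rfl⟩ := List.mem_map.1 h
    obtain ⟨b, hb, rfl⟩ := List.mem_map.1 h'
    exact D.sign_eq i j a ha b hb (σ.injective hc)

theorem iso_renameChords (σ : Equiv.Perm ℕ) (D : GaussDiagram n) : D.Iso (D.renameChords σ) :=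
  ⟨σ, fun _ => List.IsRotated.refl _⟩

theorem IsDiagram.rename {W : Fin n → List Endpoint} (h : IsDiagram W) (σ : Equiv.Perm ℕ) :
    IsDiagram (renameWords σ W) := by
  obtain ⟨D, rfl⟩ := h
  exact ⟨D.renameChords σ, rfl⟩

/-- The finite set of names of chords in a family of words. -/
def names (W : Fin n → List Endpoint) : Finset ℕ :=
  Finset.univ.biUnion fun i => ((W i).map Endpoint.chord).toFinset

theorem mem_names {W : Fin n → List Endpoint} {c : ℕ} :
    c ∈ names W ↔ ∃ i, ∃ e ∈ W i, e.chord = c := by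
  simp [names]

theorem chord_mem_names {W : Fin n → List Endpoint} {i : Fin n} {e : Endpoint} (h : e ∈ W i) :
    e.chord ∈ names W := mem_names.2 ⟨i, e, h, rfl⟩

/-! ### Gluing words into contexts. -/

namespace Context

/-- The endpoints outside the arcs of a context. -/
def base (C : Context n k) : Fin n → List Endpoint := C.fill fun _ => []

/-- Replace the arcs of a context by the parts of another context. -/
def subst (C : Context n k) (g : Context k m) : Context n m :=
  fun i => (C i).flatMap (Sum.elim (fun e => [Sum.inl e]) g)

/-- Renaming of the chords outside the arcs. -/
def rename (σ : Equiv.Perm ℕ) (C : Context n k) : Context n k :=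
  fun i => (C i).map (Sum.map (Endpoint.rename σ) id)

theorem count_flatMap_elim {α β : Type*} [BEq α] [LawfulBEq α] [BEq β] [LawfulBEq β]
    (l : List (α ⊕ Fin k)) (f : α → List β) (w : Fin k → List β) (b : β) :
    (l.flatMap (Sum.elim f w)).count b = (l.flatMap (Sum.elim f fun _ => [])).count b +
      ∑ s, l.count (Sum.inr s) * (w s).count b := by
  induction l with
  | nil => simp
  | cons x l ih =>
    rcases x with a | t
    · have h (s : Fin k) : (Sum.inl a :: l).count (Sum.inr s) = l.count (Sum.inr s) :=
        List.count_cons_of_ne (by simp)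
      simp only [List.flatMap_cons, List.count_append, ih, Sum.elim_inl, h, add_assoc]
    · have h (s : Fin k) : (Sum.inr t :: l).count (Sum.inr s) =
          l.count (Sum.inr s) + if s = t then 1 else 0 := by
        by_cases hs : s = t
        · subst hs; simp
        · rw [if_neg hs, List.count_cons_of_ne (by simpa using Ne.symm hs), add_zero]
      simp only [List.flatMap_cons, List.count_append, ih, Sum.elim_inr, h, add_mul,
        Finset.sum_add_distrib, ite_mul, one_mul, zero_mul, Finset.sum_ite_eq', Finset.mem_univ,
        if_true, List.count_nil]
      omega

/-- Each arc occurs once in all the circles together, so its word is counted exactly once. -/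
theorem Valid.sum_count {β : Type*} [BEq β] [LawfulBEq β] {C : Context n k} (hC : C.Valid)
    (f : Endpoint → List β) (w : Fin k → List β) (b : β) :
    ∑ i, ((C i).flatMap (Sum.elim f w)).count b =
      ∑ i, ((C i).flatMap (Sum.elim f fun _ => [])).count b + ∑ s, (w s).count b := by
  simp only [count_flatMap_elim _ f w b, Finset.sum_add_distrib]
  rw [Finset.sum_comm]
  simp only [← Finset.sum_mul]
  congr 1
  refine Finset.sum_congr rfl fun s _ => ?_
  rw [hC s, one_mul]

theorem Valid.mult_fill {C : Context n k} (hC : C.Valid) (v : Fin k → List Endpoint)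
    (e : Endpoint) : mult (C.fill v) e = mult C.base e + mult v e :=
  hC.sum_count _ v e

theorem Valid.mem_fill {C : Context n k} (hC : C.Valid) {v : Fin k → List Endpoint}
    {e : Endpoint} : (∃ i, e ∈ C.fill v i) ↔ (∃ i, e ∈ C.base i) ∨ ∃ s, e ∈ v s := by
  rw [← mult_pos, ← mult_pos, ← mult_pos, hC.mult_fill]
  omega

theorem fill_subst (C : Context n k) (g : Context k m) (w : Fin m → List Endpoint) :
    (C.subst g).fill w = C.fill (g.fill w) := by
  funext i
  simp only [fill, subst, List.flatMap_assoc]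
  refine congrArg (fun f => List.flatMap f (C i)) ?_
  funext x
  rcases x with e | s <;> simp [fill]

theorem base_subst (C : Context n k) (g : Context k m) : (C.subst g).base = C.fill g.base :=
  fill_subst C g _

theorem Valid.subst {C : Context n k} (hC : C.Valid) {g : Context k m} (hg : g.Valid) :
    (C.subst g).Valid := by
  intro t
  have h : ∀ l : List (Endpoint ⊕ Fin k), (l.flatMap
      (Sum.elim (fun e => [(Sum.inl e : Endpoint ⊕ Fin m)]) fun _ => [])).count (Sum.inr t) = 0 := by
    intro l
    refine List.count_eq_zero_of_not_mem ?_
    simp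
  refine (hC.sum_count (fun e => [Sum.inl e]) g (Sum.inr t)).trans ?_
  simp only [h, Finset.sum_const_zero, zero_add]
  exact hg t

theorem rename_fill (σ : Equiv.Perm ℕ) (C : Context n k) (v : Fin k → List Endpoint) :
    renameWords σ (C.fill v) = (C.rename σ).fill (renameWords σ v) := by
  funext i
  simp only [renameWords, fill, rename, List.map_flatMap, List.flatMap_map]
  refine congrArg (fun f => List.flatMap f (C i)) ?_
  funext x
  rcases x with e | s <;> simp [renameWords]

theorem rename_base (σ : Equiv.Perm ℕ) (C : Context n k) :
    (C.rename σ).base = renameWords σ C.base :=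
  (rename_fill σ C fun _ => []).symm

theorem Valid.rename {C : Context n k} (hC : C.Valid) (σ : Equiv.Perm ℕ) :
    (C.rename σ).Valid := by
  intro s
  rw [← hC s]
  refine Finset.sum_congr rfl fun i _ => ?_
  unfold Context.rename
  induction C i with
  | nil => rfl
  | cons x l ih =>
    rcases x with e | t
    · rw [List.map_cons, List.count_cons_of_ne (by simp), List.count_cons_of_ne (by simp), ih]
    · simp [List.count_cons, ih]

/-- The inserted words already contain both ends of their chords. A name shared with the outside
would give an equal or opposite endpoint, hence an endpoint of multiplicity at least two. -/
theorem Valid.isDiagram_fill {C : Context n k} (hC : C.Valid) {v : Fin k → List Endpoint}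
    (hv : IsDiagram v) : IsDiagram (C.fill v) ↔ IsDiagram C.base ∧ Apart C.base v := by
  have hv' := isDiagram_iff.1 hv
  rw [isDiagram_iff, isDiagram_iff, apart_iff]
  simp only [hC.mult_fill]
  constructor
  · rintro ⟨h1, h2, h3⟩
    refine ⟨⟨fun e => ?_, fun e => ?_, fun e f he hf => ?_⟩, fun e f he hf hc => ?_⟩
    · have := h1 e; omega
    · have := h2 e
      have := hv.mult_opposite e
      omega
    · exact h3 e f (by omega) (by omega)
    · have hs := h3 e f (by omega) (by omega) hc
      have := h1 e
      rcases Endpoint.eq_or_eq_opposite hc hs with rfl | rfl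
      · omega
      · rw [hv.mult_opposite] at this
        omega
  · rintro ⟨⟨h1, h2, h3⟩, h4⟩
    refine ⟨fun e => ?_, fun e => ?_, fun e f he hf hc => ?_⟩
    · have := h1 e
      have := hv'.1 e
      have := h4 e e
      by_contra h
      exact this (by omega) (by omega) rfl
    · have := h2 e
      have := hv'.2.1 e
      omega
    · have := h4 e f
      have h4' := h4 f e
      rcases Nat.eq_zero_or_pos (mult v e) with h | h
      · rcases Nat.eq_zero_or_pos (mult v f) with h' | h'
        · exact h3 e f (by omega) (by omega) hc
        · exact absurd hc (this (by omega) (by omega))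
      · rcases Nat.eq_zero_or_pos (mult v f) with h' | h'
        · exact absurd hc.symm (h4' (by omega) (by omega))
        · exact hv'.2.2 e f h h' hc

end Context

theorem Apart.of_names {W : Fin n → List Endpoint} {V : Fin m → List Endpoint} :
    Apart W V ↔ Disjoint (names W) (names V) := by
  rw [Finset.disjoint_left]
  constructor
  · intro h c hc hc'
    obtain ⟨i, e, he, rfl⟩ := mem_names.1 hc
    obtain ⟨j, f, hf, hef⟩ := mem_names.1 hc'
    exact h i e he j f hf hef.symm
  · intro h i e he j f hf hef
    exact h (chord_mem_names he) (hef ▸ chord_mem_names hf)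

theorem names_renameWords (σ : Equiv.Perm ℕ) (W : Fin n → List Endpoint) :
    names (renameWords σ W) = (names W).image σ := by
  ext c
  simp only [mem_names, Finset.mem_image, renameWords, List.mem_map]
  constructor
  · rintro ⟨i, _, ⟨e, he, rfl⟩, rfl⟩
    exact ⟨_, ⟨i, e, he, rfl⟩, rfl⟩
  · rintro ⟨_, ⟨i, e, he, rfl⟩, rfl⟩
    exact ⟨i, _, ⟨e, he, rfl⟩, rfl⟩

/-! ### Equivalence of diagrams and local exchange of words. -/

/-- The classes of the diagrams with the given circles are related. -/
def Rel (E : Setoid (GaussDiagram n)) (W W' : Fin n → List Endpoint) : Prop :=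
  ∃ D D' : GaussDiagram n, D.circle = W ∧ D'.circle = W' ∧ E D D'

variable {E : Setoid (GaussDiagram n)} {W W' W'' : Fin n → List Endpoint}

theorem Rel.refl (h : IsDiagram W) : Rel E W W := by
  obtain ⟨D, hD⟩ := h
  exact ⟨D, D, hD, hD, E.refl D⟩

theorem Rel.symm (h : Rel E W W') : Rel E W' W := by
  obtain ⟨D, D', h, h', hE⟩ := h
  exact ⟨D', D, h', h, E.symm hE⟩

theorem Rel.trans (h : Rel E W W') (h' : Rel E W' W'') : Rel E W W'' := by
  obtain ⟨D, D', hD, hD', hE⟩ := h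
  obtain ⟨F, F', hF, hF', hE'⟩ := h'
  cases circle_injective (hF.trans hD'.symm)
  exact ⟨D, F', hD, hF', E.trans hE hE'⟩

theorem Rel.left (h : Rel E W W') : IsDiagram W := by
  obtain ⟨D, -, hD, -⟩ := h
  exact ⟨D, hD⟩

theorem Rel.right (h : Rel E W W') : IsDiagram W' := h.symm.left

theorem Rel.apply {D D' : GaussDiagram n} (h : Rel E D.circle D'.circle) : E D D' := by
  obtain ⟨F, F', hF, hF', hE⟩ := h
  cases circle_injective hF
  cases circle_injective hF'
  exact hE

theorem rel_of_reidemeister (hE : reidemeisterSetoid n ≤ E) {D D' : GaussDiagram n}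
    (h : D.Iso D' ∨ ReidemeisterMove D D') : E D D' :=
  hE (Relation.EqvGen.rel _ _ h)

theorem rel_renameWords (hE : reidemeisterSetoid n ≤ E) (h : IsDiagram W) (σ : Equiv.Perm ℕ) :
    Rel E W (renameWords σ W) := by
  obtain ⟨D, rfl⟩ := h
  exact ⟨D, D.renameChords σ, rfl, rfl, rel_of_reidemeister hE (Or.inl (iso_renameChords σ D))⟩

theorem Rel.rename (hE : reidemeisterSetoid n ≤ E) (h : Rel E W W') (σ : Equiv.Perm ℕ) :
    Rel E (renameWords σ W) (renameWords σ W') :=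
  ((rel_renameWords hE h.left σ).symm.trans h).trans (rel_renameWords hE h.right σ)

/-- Two families of words on `k` strands may be exchanged in any Gauss diagram without changing
its class. -/
def LocEq (E : Setoid (GaussDiagram n)) (v w : Fin k → List Endpoint) : Prop :=
  ∀ C : Context n k, C.Valid → IsDiagram C.base → Apart C.base v → Apart C.base w →
    Rel E (C.fill v) (C.fill w)

namespace LocEq

variable {v w u : Fin k → List Endpoint}

theorem refl (hv : IsDiagram v) : LocEq E v v :=
  fun _ hC hb ha _ => Rel.refl ((hC.isDiagram_fill hv).2 ⟨hb, ha⟩)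

theorem symm (h : LocEq E v w) : LocEq E w v :=
  fun C hC hb hw hv => (h C hC hb hv hw).symm

theorem of_move (hv : IsDiagram v) (hw : IsDiagram w)
    (h : ∀ D D' : GaussDiagram n, LocalMove v w D D' → E D D') : LocEq E v w := by
  intro C hC hb hCv hCw
  obtain ⟨D, hD⟩ := (hC.isDiagram_fill hv).2 ⟨hb, hCv⟩
  obtain ⟨D', hD'⟩ := (hC.isDiagram_fill hw).2 ⟨hb, hCw⟩
  exact ⟨D, D', hD, hD', h D D' ⟨C, hC, hD, hD'⟩⟩

/-- The names in the intermediate word `w` may clash with those of the context. The context is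
renamed away from all three words, both exchanges are made, and the renaming is undone. -/
theorem trans (hE : reidemeisterSetoid n ≤ E) (h : LocEq E v w) (h' : LocEq E w u) :
    LocEq E v u := by
  intro C hC hb hv hu
  rw [Apart.of_names] at hv hu
  set N := (names v ∪ names w ∪ names u).sup id + 1
  have hN : ∀ x ∈ names v ∪ names w ∪ names u, x < N := fun x hx =>
    Nat.lt_succ_of_le (Finset.le_sup (f := id) hx)
  have hd : ∀ x ∈ names C.base, x ∉ names v ∧ x ∉ names u := fun x hx =>
    ⟨Finset.disjoint_left.1 hv hx, Finset.disjoint_left.1 hu hx⟩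
  -- Names in the context are shifted by `N`, beyond every name in `v`, `w`, `u`, while those in `v`
  -- and `u` stay fixed.
  obtain ⟨σ, hσ⟩ := exists_perm_eqOn (names C.base ∪ (names v ∪ names u))
    (fun x => if x ∈ names C.base then N + x else x) (by
      intro x hx y hy hxy
      simp only [Finset.coe_union, Set.mem_union, Finset.mem_coe] at hx hy
      have h1 := hN x
      have h2 := hN y
      simp only [Finset.mem_union] at h1 h2
      simp only at hxy
      split_ifs at hxy with h3 h4 h4
      · omega
      · have := h2 (by tauto)
        omega
      · have := h1 (by tauto)
        omega
      · exact hxy)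
  have hfix : ∀ x ∈ names v ∪ names u, σ x = x := by
    intro x hx
    rw [hσ x (Finset.mem_union_right _ hx), if_neg]
    intro hx'
    have := hd x hx'
    rw [Finset.mem_union] at hx
    tauto
  have hmove : ∀ z : Fin k → List Endpoint, names z ⊆ names v ∪ names w ∪ names u →
      Apart (C.rename σ).base z := by
    intro z hz
    rw [Apart.of_names, Context.rename_base, names_renameWords, Finset.disjoint_left]
    intro c hc hc'
    obtain ⟨x, hx, rfl⟩ := Finset.mem_image.1 hc
    have := hN _ (hz hc')
    rw [hσ x (Finset.mem_union_left _ hx), if_pos hx] at this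
    omega
  have hb' : IsDiagram (C.rename σ).base := by
    rw [Context.rename_base]
    exact hb.rename σ
  have hvw := h _ (hC.rename σ) hb' (hmove v fun x hx => by simp [hx])
    (hmove w fun x hx => by simp [hx])
  have hwu := h' _ (hC.rename σ) hb' (hmove w fun x hx => by simp [hx])
    (hmove u fun x hx => by simp [hx])
  have key := (hvw.trans hwu).rename hE σ.symm
  have hback : ∀ z : Fin k → List Endpoint, names z ⊆ names v ∪ names u →
      renameWords σ.symm ((C.rename σ).fill z) = C.fill z := by
    intro z hz
    have : renameWords σ z = z :=
      renameWords_eq_self fun i e he => hfix _ (hz (chord_mem_names he))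
    conv_lhs => rw [← this]
    rw [← Context.rename_fill, renameWords_symm]
  rwa [hback v fun x hx => by simp [hx], hback u fun x hx => by simp [hx]] at key

/-- A context substituted into a context is a context. Thus an exchange survives joining or
permuting strands, adding empty strands, and adjoining further chords. -/
theorem lift {v w : Fin m → List Endpoint} (h : LocEq E v w) (g : Context k m) (hg : g.Valid)
    (hb : IsDiagram g.base) (hv : Apart g.base v) (hw : Apart g.base w) :
    LocEq E (g.fill v) (g.fill w) := by
  intro C hC hCb hCv hCw
  have hap : ∀ z : Fin m → List Endpoint, Apart C.base (g.fill z) → Apart g.base z →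
      Apart (C.subst g).base z := by
    intro z h1 h2 i e he t f hf
    rw [Context.base_subst] at he
    rcases hC.mem_fill.1 ⟨i, he⟩ with ⟨j, hj⟩ | ⟨s, hs⟩
    · obtain ⟨s, hs⟩ := hg.mem_fill.2 (Or.inr ⟨t, hf⟩)
      exact h1 j e hj s f hs
    · exact h2 s e hs t f hf
  have hab : Apart C.base g.base := by
    intro i e he s f hf
    obtain ⟨t, ht⟩ := hg.mem_fill.2 (Or.inl ⟨s, hf⟩)
    exact hCv i e he t f ht
  have := h (C.subst g) (hC.subst hg)
    (by rw [Context.base_subst]; exact (hC.isDiagram_fill hb).2 ⟨hCb, hab⟩)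
    (hap v hCv hv) (hap w hCw hw)
  rwa [Context.fill_subst, Context.fill_subst] at this

/-- Since the context avoids the old and the new names, some permutation is `σ` on the names in `v`
and the identity on those of the context; it gives an isomorphism of the whole diagrams. -/
theorem renameWords_self (hE : reidemeisterSetoid n ≤ E) (hv : IsDiagram v) (σ : Equiv.Perm ℕ) :
    LocEq E v (renameWords σ v) := by
  intro C hC hb h1 h2
  have hv' := (hC.isDiagram_fill hv).2 ⟨hb, h1⟩
  rw [Apart.of_names] at h1 h2
  rw [names_renameWords] at h2
  obtain ⟨τ, hτ⟩ := exists_perm_eqOn (names C.base ∪ names v)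
    (fun x => if x ∈ names C.base then x else σ x) (by
      intro x hx y hy hxy
      simp only [Finset.coe_union, Set.mem_union, Finset.mem_coe] at hx hy
      simp only at hxy
      have key : ∀ z ∈ names v, σ z ∉ names C.base := fun z hz hz' =>
        Finset.disjoint_left.1 h2 hz' (Finset.mem_image_of_mem σ hz)
      split_ifs at hxy with h3 h4 h4
      · exact hxy
      · exact absurd (hxy ▸ h3) (key y (by tauto))
      · exact absurd (hxy ▸ h4) (key x (by tauto))
      · exact σ.injective hxy)
  have e1 : renameWords τ C.base = C.base := renameWords_eq_self fun i e he => by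
    have := chord_mem_names he
    rw [hτ _ (Finset.mem_union_left _ this), if_pos this]
  have e2 : renameWords τ v = renameWords σ v := by
    funext s
    refine List.map_congr_left fun e he => ?_
    have := chord_mem_names he
    rw [Endpoint.ext_iff]
    refine ⟨?_, rfl, rfl⟩
    rw [Endpoint.chord_rename, Endpoint.chord_rename, hτ _ (Finset.mem_union_right _ this),
      if_neg (Finset.disjoint_right.1 h1 this)]
  have e3 : C.rename τ = C := by
    funext i
    refine (List.map_congr_left (g := id) fun x hx => ?_).trans (List.map_id _)
    rcases x with e | s
    · have : e ∈ C.base i := List.mem_flatMap.2 ⟨_, hx, by simp⟩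
      have := chord_mem_names this
      have h := Endpoint.rename_eq_self (σ := τ) (e := e)
        (by rw [hτ _ (Finset.mem_union_left _ this), if_pos this])
      simp [h]
    · rfl
  have := rel_renameWords hE hv' τ
  rwa [Context.rename_fill, e2, e3] at this

theorem rename (hE : reidemeisterSetoid n ≤ E) (hv : IsDiagram v) (hw : IsDiagram w)
    (h : LocEq E v w) (σ : Equiv.Perm ℕ) : LocEq E (renameWords σ v) (renameWords σ w) :=
  ((renameWords_self hE hv σ).symm.trans hE h).trans hE (renameWords_self hE hw σ)

end LocEq

/-- The defining properties of the circles of a Gauss diagram, in decidable form. -/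
def IsClosed (W : Fin n → List Endpoint) : Prop :=
  (∀ i, (W i).Nodup) ∧ (∀ i j, i ≠ j → ∀ e ∈ W i, e ∉ W j) ∧
    (∀ i, ∀ e ∈ W i, ∃ j, e.opposite ∈ W j) ∧
      ∀ i j, ∀ e ∈ W i, ∀ f ∈ W j, e.chord = f.chord → e.sign = f.sign

instance (W : Fin n → List Endpoint) : Decidable (IsClosed W) := by
  unfold IsClosed; infer_instance

theorem IsClosed.isDiagram {W : Fin n → List Endpoint} (h : IsClosed W) : IsDiagram W :=
  isDiagram_of_decide h

/-- The words `v` and `w` on `k` strands arise from the words `v'` and `w'` on `m` strands by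
inserting them into the context `g`. -/
def Refines (g : Context k m) (v' w' : Fin m → List Endpoint) (v w : Fin k → List Endpoint) :
    Prop :=
  g.fill v' = v ∧ g.fill w' = w ∧ g.Valid ∧ IsClosed g.base ∧ Apart g.base v' ∧ Apart g.base w'

instance (g : Context k m) : Decidable g.Valid := by
  unfold Context.Valid; infer_instance

instance (g : Context k m) (v' w' : Fin m → List Endpoint) (v w : Fin k → List Endpoint) :
    Decidable (Refines g v' w' v w) := by
  unfold Refines; infer_instance

namespace LocEq

theorem refine_by {v' w' : Fin m → List Endpoint} {v w : Fin k → List Endpoint}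
    (h : LocEq E v' w') (g : Context k m) (hg : Refines g v' w' v w) : LocEq E v w := by
  obtain ⟨rfl, rfl, h1, h2, h3, h4⟩ := hg
  exact h.lift g h1 h2.isDiagram h3 h4

theorem relabel (hE : reidemeisterSetoid n ≤ E) {v w : Fin k → List Endpoint}
    (σ : Equiv.Perm ℕ) (h : IsClosed v ∧ renameWords σ v = w) : LocEq E v w := by
  obtain ⟨h, rfl⟩ := h
  exact renameWords_self hE h.isDiagram σ

/-- A first Reidemeister move inside other words. -/
theorem one (hE : reidemeisterSetoid n ≤ E) (c : ℕ) (o : Bool) (ε : ℤˣ) :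
    LocEq E ![[⟨c, o, ε⟩, ⟨c, !o, ε⟩]] ![[]] := by
  refine of_move (IsClosed.isDiagram ?_) (IsClosed.isDiagram (by decide)) fun D D' h =>
    rel_of_reidemeister hE (Or.inr (.one c o ε D D' h))
  cases o <;> simp [IsClosed, Endpoint.opposite]

theorem one_refine (hE : reidemeisterSetoid n ≤ E) {v w : Fin k → List Endpoint}
    (c : ℕ) (o : Bool) (ε : ℤˣ) (g : Context k 1)
    (hg : Refines g ![[⟨c, o, ε⟩, ⟨c, !o, ε⟩]] ![[]] v w) : LocEq E v w :=
  (one hE c o ε).refine_by g hg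

theorem two_parallel (hE : reidemeisterSetoid n ≤ E) {v w : Fin k → List Endpoint}
    (c d : ℕ) (ε : ℤˣ) (g : Context k 2)
    (h : IsClosed ![[overEnd c ε, overEnd d (-ε)], [underEnd c ε, underEnd d (-ε)]] ∧
      Refines g ![[], []] ![[overEnd c ε, overEnd d (-ε)], [underEnd c ε, underEnd d (-ε)]] v w) :
    LocEq E v w :=
  refine_by (symm (of_move h.1.isDiagram (IsClosed.isDiagram (by decide)) fun D D' hm =>
    rel_of_reidemeister hE (Or.inr (.two_parallel c d ε D D' hm)))) g h.2

theorem two_antiparallel (hE : reidemeisterSetoid n ≤ E) {v w : Fin k → List Endpoint}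
    (c d : ℕ) (ε : ℤˣ) (g : Context k 2)
    (h : IsClosed ![[overEnd c ε, overEnd d (-ε)], [underEnd d (-ε), underEnd c ε]] ∧
      Refines g ![[], []] ![[overEnd c ε, overEnd d (-ε)], [underEnd d (-ε), underEnd c ε]] v w) :
    LocEq E v w :=
  refine_by (symm (of_move h.1.isDiagram (IsClosed.isDiagram (by decide)) fun D D' hm =>
    rel_of_reidemeister hE (Or.inr (.two_antiparallel c d ε D D' hm)))) g h.2

theorem sharp (hX : ∀ D D' : GaussDiagram n, VSharp D D' → E D D') {v w : Fin k → List Endpoint}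
    (c : Fin 2 → Fin 2 → ℕ) (ε : ℤˣ) (g : Context k 4)
    (h : IsClosed (sharpCrossings c ε) ∧ Refines g (sharpCrossings c ε) (fun _ => []) v w) :
    LocEq E v w :=
  refine_by (of_move h.1.isDiagram (IsClosed.isDiagram (by decide)) fun D D' hm =>
    hX D D' ⟨c, ε, hm⟩) g h.2

theorem delta (hX : ∀ D D' : GaussDiagram n, VDeltaWedge D D' → E D D')
    {v w : Fin k → List Endpoint} (c : Fin 3 → ℕ) (ε : ℤˣ) (s : Fin 3 → ℤˣ) (g : Context k 3)
    (h : (∃ j k, s j ≠ s k) ∧ IsClosed (deltaCrossings c ε s) ∧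
      Refines g (deltaCrossings c ε s) (fun _ => []) v w) : LocEq E v w :=
  refine_by (of_move h.2.1.isDiagram (IsClosed.isDiagram (by decide)) fun D D' hm =>
    hX D D' ⟨c, ε, s, h.1, hm⟩) g h.2.2

end LocEq

/-! ### Changing the types of chords. -/

theorem units_eq_or_eq_neg : ∀ ε δ : ℤˣ, ε = δ ∨ δ = -ε := by decide

/-- Direction and sign of a chord may be changed. -/
def ChangesType (E : Setoid (GaussDiagram n)) (o : Bool) (ε : ℤˣ) (o' : Bool) (ε' : ℤˣ) : Prop :=
  LocEq E ![[⟨0, o, ε⟩], [⟨0, !o, ε⟩]] ![[⟨0, o', ε'⟩], [⟨0, !o', ε'⟩]]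

/-- A chord may be split into two chords meeting at a new place. -/
def Splits (E : Setoid (GaussDiagram n)) (o : Bool) (ε : ℤˣ) (o₁ : Bool) (ε₁ : ℤˣ) (o₂ : Bool)
    (ε₂ : ℤˣ) : Prop :=
  LocEq E ![[⟨0, o, ε⟩], [⟨0, !o, ε⟩], []]
    ![[⟨1, o₁, ε₁⟩], [⟨2, o₂, ε₂⟩], [⟨1, !o₁, ε₁⟩, ⟨2, !o₂, ε₂⟩]]

theorem isDiagram_chord (c : ℕ) (o : Bool) (ε : ℤˣ) :
    IsDiagram ![[⟨c, o, ε⟩], [⟨c, !o, ε⟩]] := by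
  apply IsClosed.isDiagram
  cases o <;> simp [IsClosed, Fin.forall_fin_succ, Fin.exists_fin_succ, Endpoint.opposite]

/-- The two strands are interchangeable, so the chord may be read from its other end. -/
theorem ChangesType.flip {o o' : Bool} {ε ε' : ℤˣ} (h : ChangesType E o ε o' ε') :
    ChangesType E (!o) ε (!o') ε' := by
  refine h.refine_by ![[Sum.inr 1], [Sum.inr 0]] ⟨?_, ?_, by decide, by decide, ?_, ?_⟩
  · funext s; fin_cases s <;> simp [Context.fill]
  · funext s; fin_cases s <;> simp [Context.fill]
  · simp [Apart, Context.base, Context.fill, Fin.forall_fin_succ]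
  · simp [Apart, Context.base, Context.fill, Fin.forall_fin_succ]

theorem ChangesType.all (hE : reidemeisterSetoid n ≤ E)
    (h1 : ∀ ε, ∃ δ, ChangesType E true ε false δ) (h2 : ∀ ε, ChangesType E true ε true (-ε))
    (o : Bool) (ε : ℤˣ) (o' : Bool) (ε' : ℤˣ) : ChangesType E o ε o' ε' := by
  have hs : ∀ o ε ε', ChangesType E o ε o ε' := by
    intro o ε ε'
    rcases units_eq_or_eq_neg ε ε' with rfl | rfl
    · exact LocEq.refl (isDiagram_chord _ _ _)
    · cases o
      · exact (h2 ε).flip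
      · exact h2 ε
  by_cases ho : o = o'
  · subst ho; exact hs o ε ε'
  · have : o' = !o := by cases o <;> cases o' <;> simp_all
    subst this
    obtain ⟨δ, hδ⟩ := h1 ε
    cases o
    · exact LocEq.trans hE hδ.flip (hs true δ ε')
    · exact LocEq.trans hE hδ (hs false δ ε')

theorem ChangesType.at (hE : reidemeisterSetoid n ≤ E) {o o' : Bool} {ε ε' : ℤˣ}
    (h : ChangesType E o ε o' ε') (c : ℕ) :
    LocEq E ![[⟨c, o, ε⟩], [⟨c, !o, ε⟩]] ![[⟨c, o', ε'⟩], [⟨c, !o', ε'⟩]] := by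
  have := LocEq.rename hE (isDiagram_chord _ _ _) (isDiagram_chord _ _ _) h (Equiv.swap 0 c)
  convert this using 1 <;> funext s <;> fin_cases s <;>
    simp [renameWords, Endpoint.rename]

/-- One splitting suffices: the type of the chord is adjusted beforehand and the types of the two
pieces afterwards. -/
theorem Splits.all (hE : reidemeisterSetoid n ≤ E)
    (ht : ∀ o ε o' ε', ChangesType E o ε o' ε')
    {p : Bool} {δ : ℤˣ} {p₁ : Bool} {δ₁ : ℤˣ} {p₂ : Bool} {δ₂ : ℤˣ}
    (h : Splits E p δ p₁ δ₁ p₂ δ₂) (o : Bool) (ε : ℤˣ) (o₁ : Bool) (ε₁ : ℤˣ) (o₂ : Bool) (ε₂ : ℤˣ) :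
    Splits E o ε o₁ ε₁ o₂ ε₂ := by
  have s0 : LocEq E ![[⟨0, o, ε⟩], [⟨0, !o, ε⟩], []] ![[⟨0, p, δ⟩], [⟨0, !p, δ⟩], []] := by
    refine (ht o ε p δ).refine_by ![[Sum.inr 0], [Sum.inr 1], []]
      ⟨?_, ?_, by decide, by decide, ?_, ?_⟩
    · funext s; fin_cases s <;> simp [Context.fill]
    · funext s; fin_cases s <;> simp [Context.fill]
    · simp [Apart, Context.base, Context.fill, Fin.forall_fin_succ]
    · simp [Apart, Context.base, Context.fill, Fin.forall_fin_succ]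
  have s1 : LocEq E ![[⟨1, p₁, δ₁⟩], [⟨2, p₂, δ₂⟩], [⟨1, !p₁, δ₁⟩, ⟨2, !p₂, δ₂⟩]]
      ![[⟨1, o₁, ε₁⟩], [⟨2, p₂, δ₂⟩], [⟨1, !o₁, ε₁⟩, ⟨2, !p₂, δ₂⟩]] := by
    refine ((ht p₁ δ₁ o₁ ε₁).at hE 1).refine_by
      ![[Sum.inr 0], [Sum.inl ⟨2, p₂, δ₂⟩], [Sum.inr 1, Sum.inl ⟨2, !p₂, δ₂⟩]]
      ⟨?_, ?_, ?_, ?_, ?_, ?_⟩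
    · funext s; fin_cases s <;> simp [Context.fill]
    · funext s; fin_cases s <;> simp [Context.fill]
    · intro t; fin_cases t <;> simp [Fin.sum_univ_succ]
    · cases p₂ <;> simp [IsClosed, Context.base, Context.fill, Fin.forall_fin_succ,
        Fin.exists_fin_succ, Endpoint.opposite]
    · simp [Apart, Context.base, Context.fill, Fin.forall_fin_succ]
    · simp [Apart, Context.base, Context.fill, Fin.forall_fin_succ]
  have s2 : LocEq E ![[⟨1, o₁, ε₁⟩], [⟨2, p₂, δ₂⟩], [⟨1, !o₁, ε₁⟩, ⟨2, !p₂, δ₂⟩]]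
      ![[⟨1, o₁, ε₁⟩], [⟨2, o₂, ε₂⟩], [⟨1, !o₁, ε₁⟩, ⟨2, !o₂, ε₂⟩]] := by
    refine ((ht p₂ δ₂ o₂ ε₂).at hE 2).refine_by
      ![[Sum.inl ⟨1, o₁, ε₁⟩], [Sum.inr 0], [Sum.inl ⟨1, !o₁, ε₁⟩, Sum.inr 1]]
      ⟨?_, ?_, ?_, ?_, ?_, ?_⟩
    · funext s; fin_cases s <;> simp [Context.fill]
    · funext s; fin_cases s <;> simp [Context.fill]
    · intro t; fin_cases t <;> simp [Fin.sum_univ_succ]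
    · cases o₁ <;> simp [IsClosed, Context.base, Context.fill, Fin.forall_fin_succ,
        Fin.exists_fin_succ, Endpoint.opposite]
    · simp [Apart, Context.base, Context.fill, Fin.forall_fin_succ]
    · simp [Apart, Context.base, Context.fill, Fin.forall_fin_succ]
  exact ((LocEq.trans hE s0 h).trans hE s1).trans hE s2

/-! ### Splitting chords by $v\sharp$-moves. -/

/-- Up to `v♯`-moves, a chord is replaced by three chords of the opposite sign. -/
theorem sharp_triple (hE : reidemeisterSetoid n ≤ E)
    (hX : ∀ D D' : GaussDiagram n, VSharp D D' → E D D') (ε : ℤˣ) :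
    LocEq E ![[⟨0, true, ε⟩], [⟨0, false, ε⟩], [], []]
      ![[⟨4, true, -ε⟩], [⟨5, false, -ε⟩], [⟨6, true, -ε⟩, ⟨5, true, -ε⟩],
        [⟨4, false, -ε⟩, ⟨6, false, -ε⟩]] := by
  -- The chords `1`, `2`, `3` missing from a $\sharp$-pattern around chord `0` are created together
  -- with cancelling partners `4`, `5`, `6`.
  have h1 : LocEq E ![[⟨0, true, ε⟩], [⟨0, false, ε⟩], [], []]
      ![[⟨0, true, ε⟩, ⟨1, true, ε⟩, ⟨4, true, -ε⟩], [⟨0, false, ε⟩], [],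
        [⟨4, false, -ε⟩, ⟨1, false, ε⟩]] := by
    refine LocEq.two_antiparallel hE 1 4 ε
      ![[Sum.inl ⟨0, true, ε⟩, Sum.inr 0], [Sum.inl ⟨0, false, ε⟩], [], [Sum.inr 1]] ?_
    rcases Int.units_eq_one_or ε with rfl | rfl <;> decide
  have h2 : LocEq E ![[⟨0, true, ε⟩, ⟨1, true, ε⟩, ⟨4, true, -ε⟩], [⟨0, false, ε⟩], [],
        [⟨4, false, -ε⟩, ⟨1, false, ε⟩]]
      ![[⟨0, true, ε⟩, ⟨1, true, ε⟩, ⟨4, true, -ε⟩],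
        [⟨0, false, ε⟩, ⟨2, false, ε⟩, ⟨5, false, -ε⟩], [⟨2, true, ε⟩, ⟨5, true, -ε⟩],
        [⟨4, false, -ε⟩, ⟨1, false, ε⟩]] := by
    refine LocEq.two_parallel hE 2 5 ε
      ![[Sum.inl ⟨0, true, ε⟩, Sum.inl ⟨1, true, ε⟩, Sum.inl ⟨4, true, -ε⟩],
        [Sum.inl ⟨0, false, ε⟩, Sum.inr 1], [Sum.inr 0],
        [Sum.inl ⟨4, false, -ε⟩, Sum.inl ⟨1, false, ε⟩]] ?_
    rcases Int.units_eq_one_or ε with rfl | rfl <;> decide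
  have h3 : LocEq E ![[⟨0, true, ε⟩, ⟨1, true, ε⟩, ⟨4, true, -ε⟩],
        [⟨0, false, ε⟩, ⟨2, false, ε⟩, ⟨5, false, -ε⟩], [⟨2, true, ε⟩, ⟨5, true, -ε⟩],
        [⟨4, false, -ε⟩, ⟨1, false, ε⟩]]
      ![[⟨0, true, ε⟩, ⟨1, true, ε⟩, ⟨4, true, -ε⟩],
        [⟨0, false, ε⟩, ⟨2, false, ε⟩, ⟨5, false, -ε⟩],
        [⟨2, true, ε⟩, ⟨3, true, ε⟩, ⟨6, true, -ε⟩, ⟨5, true, -ε⟩],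
        [⟨4, false, -ε⟩, ⟨1, false, ε⟩, ⟨3, false, ε⟩, ⟨6, false, -ε⟩]] := by
    refine LocEq.two_parallel hE 3 6 ε
      ![[Sum.inl ⟨0, true, ε⟩, Sum.inl ⟨1, true, ε⟩, Sum.inl ⟨4, true, -ε⟩],
        [Sum.inl ⟨0, false, ε⟩, Sum.inl ⟨2, false, ε⟩, Sum.inl ⟨5, false, -ε⟩],
        [Sum.inl ⟨2, true, ε⟩, Sum.inr 0, Sum.inl ⟨5, true, -ε⟩],
        [Sum.inl ⟨4, false, -ε⟩, Sum.inl ⟨1, false, ε⟩, Sum.inr 1]] ?_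
    rcases Int.units_eq_one_or ε with rfl | rfl <;> decide
  -- Strands `0` and `2` now run over strands `1` and `3` in the chords `0` to `3`; deleting these
  -- leaves the partners.
  refine ((h1.trans hE h2).trans hE h3).trans hE (LocEq.sharp hX ![![0, 1], ![2, 3]] ε
    ![[Sum.inr 0, Sum.inl ⟨4, true, -ε⟩], [Sum.inr 2, Sum.inl ⟨5, false, -ε⟩],
      [Sum.inr 1, Sum.inl ⟨6, true, -ε⟩, Sum.inl ⟨5, true, -ε⟩],
      [Sum.inl ⟨4, false, -ε⟩, Sum.inr 3, Sum.inl ⟨6, false, -ε⟩]] ?_)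
  rcases Int.units_eq_one_or ε with rfl | rfl <;> decide

/-- Joining the four strands of `sharp_triple` in different ways makes some of the three new chords
isolated. What remains is a splitting, a change of sign, or a reversal. -/
theorem splits_of_sharp (hE : reidemeisterSetoid n ≤ E)
    (hX : ∀ D D' : GaussDiagram n, VSharp D D' → E D D')
    (o : Bool) (ε : ℤˣ) (o₁ : Bool) (ε₁ : ℤˣ) (o₂ : Bool) (ε₂ : ℤˣ) :
    Splits E o ε o₁ ε₁ o₂ ε₂ := by
  have hs : ∀ ε, LocEq E ![[⟨0, true, ε⟩], [⟨0, false, ε⟩], []]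
      ![[⟨4, true, -ε⟩], [⟨5, false, -ε⟩], [⟨4, false, -ε⟩, ⟨5, true, -ε⟩]] := by
    intro ε
    have h1 : LocEq E ![[⟨0, true, ε⟩], [⟨0, false, ε⟩], []]
        ![[⟨4, true, -ε⟩], [⟨5, false, -ε⟩],
          [⟨4, false, -ε⟩, ⟨6, false, -ε⟩, ⟨6, true, -ε⟩, ⟨5, true, -ε⟩]] := by
      -- Strand `3` followed by strand `2` brings the ends of chord `6` together.
      refine (sharp_triple hE hX ε).refine_by ![[Sum.inr 0], [Sum.inr 1], [Sum.inr 3, Sum.inr 2]] ?_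
      rcases Int.units_eq_one_or ε with rfl | rfl <;> decide
    refine h1.trans hE (LocEq.one_refine hE 6 false (-ε) ![[Sum.inl ⟨4, true, -ε⟩],
      [Sum.inl ⟨5, false, -ε⟩], [Sum.inl ⟨4, false, -ε⟩, Sum.inr 0, Sum.inl ⟨5, true, -ε⟩]] ?_)
    rcases Int.units_eq_one_or ε with rfl | rfl <;> decide
  have hsign : ∀ ε, ChangesType E true ε true (-ε) := by
    intro ε
    have h1 : LocEq E ![[⟨0, true, ε⟩], [⟨0, false, ε⟩]]
        ![[⟨4, true, -ε⟩, ⟨4, false, -ε⟩, ⟨5, true, -ε⟩], [⟨5, false, -ε⟩]] := by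
      -- Placing the new arc right after the initial end isolates chord `4`.
      refine (hs ε).refine_by ![[Sum.inr 0, Sum.inr 2], [Sum.inr 1]] ?_
      rcases Int.units_eq_one_or ε with rfl | rfl <;> decide
    have h2 : LocEq E ![[⟨4, true, -ε⟩, ⟨4, false, -ε⟩, ⟨5, true, -ε⟩], [⟨5, false, -ε⟩]]
        ![[⟨5, true, -ε⟩], [⟨5, false, -ε⟩]] := by
      refine LocEq.one_refine hE 4 true (-ε)
        ![[Sum.inr 0, Sum.inl ⟨5, true, -ε⟩], [Sum.inl ⟨5, false, -ε⟩]] ?_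
      rcases Int.units_eq_one_or ε with rfl | rfl <;> decide
    refine (h1.trans hE h2).trans hE (LocEq.relabel hE (Equiv.swap 0 5) ?_)
    rcases Int.units_eq_one_or ε with rfl | rfl <;> decide
  have hrev : ∀ ε, ChangesType E true ε false (-ε) := by
    intro ε
    have h1 : LocEq E ![[⟨0, true, ε⟩], [⟨0, false, ε⟩]]
        ![[⟨4, true, -ε⟩, ⟨4, false, -ε⟩, ⟨6, false, -ε⟩],
          [⟨6, true, -ε⟩, ⟨5, true, -ε⟩, ⟨5, false, -ε⟩]] := by
      -- Chords `4` and `5` become isolated; chord `6` joins the two strands in the reverse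
      -- direction.
      refine (sharp_triple hE hX ε).refine_by ![[Sum.inr 0, Sum.inr 3], [Sum.inr 2, Sum.inr 1]] ?_
      rcases Int.units_eq_one_or ε with rfl | rfl <;> decide
    have h2 : LocEq E ![[⟨4, true, -ε⟩, ⟨4, false, -ε⟩, ⟨6, false, -ε⟩],
          [⟨6, true, -ε⟩, ⟨5, true, -ε⟩, ⟨5, false, -ε⟩]]
        ![[⟨6, false, -ε⟩], [⟨6, true, -ε⟩, ⟨5, true, -ε⟩, ⟨5, false, -ε⟩]] := by
      refine LocEq.one_refine hE 4 true (-ε) ![[Sum.inr 0, Sum.inl ⟨6, false, -ε⟩],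
        [Sum.inl ⟨6, true, -ε⟩, Sum.inl ⟨5, true, -ε⟩, Sum.inl ⟨5, false, -ε⟩]] ?_
      rcases Int.units_eq_one_or ε with rfl | rfl <;> decide
    have h3 : LocEq E ![[⟨6, false, -ε⟩], [⟨6, true, -ε⟩, ⟨5, true, -ε⟩, ⟨5, false, -ε⟩]]
        ![[⟨6, false, -ε⟩], [⟨6, true, -ε⟩]] := by
      refine LocEq.one_refine hE 5 true (-ε) ![[Sum.inl ⟨6, false, -ε⟩],
        [Sum.inl ⟨6, true, -ε⟩, Sum.inr 0]] ?_
      rcases Int.units_eq_one_or ε with rfl | rfl <;> decide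
    refine ((h1.trans hE h2).trans hE h3).trans hE (LocEq.relabel hE (Equiv.swap 0 6) ?_)
    rcases Int.units_eq_one_or ε with rfl | rfl <;> decide
  have hsplit : Splits E true 1 true (-1) false (-1) :=
    (hs 1).trans hE (LocEq.relabel hE (Equiv.swap 1 4 * Equiv.swap 2 5) (by decide))
  exact hsplit.all hE (ChangesType.all hE (fun ε => ⟨-ε, hrev ε⟩) hsign) o ε o₁ ε₁ o₂ ε₂

/-! ### Splitting chords by $v\Delta^\wedge$-moves. -/

/-- Up to `vΔ^∧`-moves, a chord is replaced by two chords which form a coherent triangle with it.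
The signs come from the choice of the strand whose direction differs from the others. -/
theorem delta_pair (hE : reidemeisterSetoid n ≤ E)
    (hX : ∀ D D' : GaussDiagram n, VDeltaWedge D D' → E D D') (ε δ : ℤˣ) :
    LocEq E ![[⟨0, true, ε⟩], [⟨0, false, ε⟩], []]
      ![[⟨4, false, -δ⟩], [⟨3, true, δ⟩], [⟨3, false, δ⟩, ⟨4, true, -δ⟩]] := by
  rcases units_eq_or_eq_neg ε δ with rfl | rfl
  · have h1 : LocEq E ![[⟨0, true, ε⟩], [⟨0, false, ε⟩], []]
        ![[⟨0, true, ε⟩], [⟨0, false, ε⟩, ⟨1, true, -ε⟩, ⟨3, true, ε⟩],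
          [⟨3, false, ε⟩, ⟨1, false, -ε⟩]] := by
      refine LocEq.two_antiparallel hE 1 3 (-ε)
        ![[Sum.inl ⟨0, true, ε⟩], [Sum.inl ⟨0, false, ε⟩, Sum.inr 0], [Sum.inr 1]] ?_
      rcases Int.units_eq_one_or ε with rfl | rfl <;> decide
    have h2 : LocEq E
        ![[⟨0, true, ε⟩], [⟨0, false, ε⟩, ⟨1, true, -ε⟩, ⟨3, true, ε⟩],
          [⟨3, false, ε⟩, ⟨1, false, -ε⟩]]
        ![[⟨0, true, ε⟩, ⟨2, false, ε⟩, ⟨4, false, -ε⟩],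
          [⟨0, false, ε⟩, ⟨1, true, -ε⟩, ⟨3, true, ε⟩],
          [⟨3, false, ε⟩, ⟨1, false, -ε⟩, ⟨2, true, ε⟩, ⟨4, true, -ε⟩]] := by
      refine LocEq.two_parallel hE 2 4 ε
        ![[Sum.inl ⟨0, true, ε⟩, Sum.inr 1],
          [Sum.inl ⟨0, false, ε⟩, Sum.inl ⟨1, true, -ε⟩, Sum.inl ⟨3, true, ε⟩],
          [Sum.inl ⟨3, false, ε⟩, Sum.inl ⟨1, false, -ε⟩, Sum.inr 0]] ?_
      rcases Int.units_eq_one_or ε with rfl | rfl <;> decide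
    -- With strand `0` reversed, the triangle has signs `ε, -ε, ε`; the survivors `3` and `4` are
    -- the cancelling partners of `1` and `2`.
    refine (h1.trans hE h2).trans hE (LocEq.delta hX ![0, 1, 2] (-ε) ![-1, 1, 1]
      ![[Sum.inr 0, Sum.inl ⟨4, false, -ε⟩], [Sum.inr 1, Sum.inl ⟨3, true, ε⟩],
        [Sum.inl ⟨3, false, ε⟩, Sum.inr 2, Sum.inl ⟨4, true, -ε⟩]] ?_)
    rcases Int.units_eq_one_or ε with rfl | rfl <;> decide
  · have h1 : LocEq E ![[⟨0, true, ε⟩], [⟨0, false, ε⟩], []]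
        ![[⟨0, true, ε⟩], [⟨3, true, -ε⟩, ⟨1, true, ε⟩, ⟨0, false, ε⟩],
          [⟨3, false, -ε⟩, ⟨1, false, ε⟩]] := by
      refine LocEq.two_parallel hE 3 1 (-ε)
        ![[Sum.inl ⟨0, true, ε⟩], [Sum.inr 0, Sum.inl ⟨0, false, ε⟩], [Sum.inr 1]] ?_
      rcases Int.units_eq_one_or ε with rfl | rfl <;> decide
    have h2 : LocEq E
        ![[⟨0, true, ε⟩], [⟨3, true, -ε⟩, ⟨1, true, ε⟩, ⟨0, false, ε⟩],
          [⟨3, false, -ε⟩, ⟨1, false, ε⟩]]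
        ![[⟨4, false, ε⟩, ⟨2, false, -ε⟩, ⟨0, true, ε⟩],
          [⟨3, true, -ε⟩, ⟨1, true, ε⟩, ⟨0, false, ε⟩],
          [⟨3, false, -ε⟩, ⟨1, false, ε⟩, ⟨2, true, -ε⟩, ⟨4, true, ε⟩]] := by
      refine LocEq.two_antiparallel hE 2 4 (-ε)
        ![[Sum.inr 1, Sum.inl ⟨0, true, ε⟩],
          [Sum.inl ⟨3, true, -ε⟩, Sum.inl ⟨1, true, ε⟩, Sum.inl ⟨0, false, ε⟩],
          [Sum.inl ⟨3, false, -ε⟩, Sum.inl ⟨1, false, ε⟩, Sum.inr 0]] ?_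
      rcases Int.units_eq_one_or ε with rfl | rfl <;> decide
    -- With strand `1` reversed instead, the signs are `ε, ε, -ε`.
    refine (h1.trans hE h2).trans hE (LocEq.delta hX ![0, 1, 2] (-ε) ![1, -1, 1]
      ![[Sum.inl ⟨4, false, ε⟩, Sum.inr 0], [Sum.inl ⟨3, true, -ε⟩, Sum.inr 1],
        [Sum.inl ⟨3, false, -ε⟩, Sum.inr 2, Sum.inl ⟨4, true, ε⟩]] ?_)
    rcases Int.units_eq_one_or ε with rfl | rfl <;> decide

theorem splits_of_delta (hE : reidemeisterSetoid n ≤ E)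
    (hX : ∀ D D' : GaussDiagram n, VDeltaWedge D D' → E D D')
    (o : Bool) (ε : ℤˣ) (o₁ : Bool) (ε₁ : ℤˣ) (o₂ : Bool) (ε₂ : ℤˣ) :
    Splits E o ε o₁ ε₁ o₂ ε₂ := by
  have hrev : ∀ ε δ, ChangesType E true ε false δ := by
    intro ε δ
    have h1 : LocEq E ![[⟨0, true, ε⟩], [⟨0, false, ε⟩]]
        ![[⟨3, false, δ⟩, ⟨4, true, -δ⟩, ⟨4, false, -δ⟩], [⟨3, true, δ⟩]] := by
      -- Strand `2` followed by strand `0` isolates chord `4`; chord `3` remains, reversed and with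
      -- the free sign `δ`.
      refine (delta_pair hE hX ε δ).refine_by ![[Sum.inr 2, Sum.inr 0], [Sum.inr 1]] ?_
      rcases Int.units_eq_one_or ε with rfl | rfl <;>
        rcases Int.units_eq_one_or δ with rfl | rfl <;> decide
    have h2 : LocEq E ![[⟨3, false, δ⟩, ⟨4, true, -δ⟩, ⟨4, false, -δ⟩], [⟨3, true, δ⟩]]
        ![[⟨3, false, δ⟩], [⟨3, true, δ⟩]] := by
      refine LocEq.one_refine hE 4 true (-δ)
        ![[Sum.inl ⟨3, false, δ⟩, Sum.inr 0], [Sum.inl ⟨3, true, δ⟩]] ?_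
      rcases Int.units_eq_one_or δ with rfl | rfl <;> decide
    refine (h1.trans hE h2).trans hE (LocEq.relabel hE (Equiv.swap 0 3) ?_)
    rcases Int.units_eq_one_or δ with rfl | rfl <;> decide
  have hpair : Splits E false 1 true 1 false (-1) := by
    have h1 : LocEq E ![[⟨0, false, 1⟩], [⟨0, true, 1⟩], []]
        ![[⟨3, true, 1⟩], [⟨4, false, -1⟩], [⟨3, false, 1⟩, ⟨4, true, -1⟩]] :=
      (delta_pair hE hX 1 1).refine_by ![[Sum.inr 1], [Sum.inr 0], [Sum.inr 2]] (by decide)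
    exact h1.trans hE (LocEq.relabel hE (Equiv.swap 1 3 * Equiv.swap 2 4) (by decide))
  -- A change of sign is a reversal followed by an inverse reversal, through a reversed chord of
  -- sign `1`.
  exact hpair.all hE (ChangesType.all hE (fun ε => ⟨ε, hrev ε ε⟩)
    fun ε => (hrev ε 1).trans hE (hrev (-ε) 1).symm) o ε o₁ ε₁ o₂ ε₂

/-! ### Exchanging endpoints along the circles. -/

theorem LocEq.apply_of_isDiagram {v w : Fin k → List Endpoint} (h : LocEq E v w)
    {C : Context n k} (hC : C.Valid) (hv : IsDiagram v) (hCv : IsDiagram (C.fill v))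
    (hw : Apart C.base w) : Rel E (C.fill v) (C.fill w) := by
  obtain ⟨h1, h2⟩ := (hC.isDiagram_fill hv).1 hCv
  exact h C hC h1 h2 hw

/-- An isolated chord can be deleted and recreated with its ends in the other order. -/
theorem LocEq.swap_of_same_chord (hE : reidemeisterSetoid n ≤ E) (e : Endpoint) :
    LocEq E ![[e, e.opposite]] ![[e.opposite, e]] := by
  have h := LocEq.one hE e.chord (!e.isOver) e.sign
  rw [Bool.not_not] at h
  exact (LocEq.one hE e.chord e.isOver e.sign).trans hE h.symm

/-- If chords can be split, then adjacent endpoints of different chords can be exchanged. -/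
theorem LocEq.swap_of_splits (hE : reidemeisterSetoid n ≤ E)
    (hS : ∀ o ε o₁ ε₁ o₂ ε₂, Splits E o ε o₁ ε₁ o₂ ε₂) {e f : Endpoint}
    (hef : e.chord ≠ f.chord) :
    LocEq E ![[e, f], [e.opposite], [f.opposite]] ![[f, e], [e.opposite], [f.opposite]] := by
  obtain ⟨c, o, ε⟩ := e
  obtain ⟨d, p, δ⟩ := f
  have hne : c ≠ d := hef
  -- An auxiliary chord joins the places of the two opposite endpoints. Split at the place of the
  -- pair, it yields the order `e, f`; read from its other end, it yields `f, e`.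
  have h1 : LocEq E ![[⟨0, true, 1⟩], [⟨0, false, 1⟩], []]
      ![[⟨1, !o, ε⟩], [⟨2, !p, δ⟩], [⟨1, o, ε⟩, ⟨2, p, δ⟩]] := by
    have := hS true 1 (!o) ε (!p) δ
    rwa [Splits, Bool.not_not, Bool.not_not] at this
  have h2 : LocEq E ![[⟨0, true, 1⟩], [⟨0, false, 1⟩], []]
      ![[⟨1, !o, ε⟩], [⟨2, !p, δ⟩], [⟨2, p, δ⟩, ⟨1, o, ε⟩]] := by
    have h : LocEq E ![[⟨0, true, 1⟩], [⟨0, false, 1⟩], []]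
        ![[⟨2, !o, ε⟩], [⟨1, !p, δ⟩], [⟨1, p, δ⟩, ⟨2, o, ε⟩]] := by
      have := hS false 1 (!p) δ (!o) ε
      rw [Splits, Bool.not_not, Bool.not_not] at this
      refine this.refine_by ![[Sum.inr 1], [Sum.inr 0], [Sum.inr 2]]
        ⟨?_, ?_, by decide, by decide, ?_, ?_⟩
      · funext s; fin_cases s <;> simp [Context.fill]
      · funext s; fin_cases s <;> simp [Context.fill]
      · simp [Apart, Context.base, Context.fill, Fin.forall_fin_succ]
      · simp [Apart, Context.base, Context.fill, Fin.forall_fin_succ]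
    refine h.trans hE (LocEq.relabel hE (Equiv.swap 1 2) ⟨?_, ?_⟩)
    · cases o <;> cases p <;>
        simp [IsClosed, Fin.forall_fin_succ, Fin.exists_fin_succ, Endpoint.opposite]
    · funext s
      fin_cases s <;> simp [renameWords, Endpoint.rename]
  have h3 := (h1.symm.trans hE h2).refine_by
    (v := ![[⟨1, o, ε⟩, ⟨2, p, δ⟩], [⟨1, !o, ε⟩], [⟨2, !p, δ⟩]])
    (w := ![[⟨2, p, δ⟩, ⟨1, o, ε⟩], [⟨1, !o, ε⟩], [⟨2, !p, δ⟩]])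
    ![[Sum.inr 2], [Sum.inr 0], [Sum.inr 1]] ⟨by
      funext s; fin_cases s <;> simp [Context.fill], by
      funext s; fin_cases s <;> simp [Context.fill], by decide, by decide, by
      simp [Apart, Context.base, Context.fill, Fin.forall_fin_succ], by
      simp [Apart, Context.base, Context.fill, Fin.forall_fin_succ]⟩
  obtain ⟨σ, hσ⟩ := exists_perm_eqOn {1, 2} (fun x => if x = 1 then c else d) (by
    intro x hx y hy hxy
    simp only [Finset.coe_insert, Finset.coe_singleton, Set.mem_insert_iff,
      Set.mem_singleton_iff] at hx hy
    rcases hx with rfl | rfl <;> rcases hy with rfl | rfl <;> simp_all)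
  have hσ1 : σ 1 = c := hσ 1 (by simp)
  have hσ2 : σ 2 = d := hσ 2 (by simp)
  have hv : IsDiagram ![[⟨1, o, ε⟩, ⟨2, p, δ⟩], [⟨1, !o, ε⟩], [⟨2, !p, δ⟩]] := by
    apply IsClosed.isDiagram
    cases o <;> cases p <;>
      simp [IsClosed, Fin.forall_fin_succ, Fin.exists_fin_succ, Endpoint.opposite]
  have hw : IsDiagram ![[⟨2, p, δ⟩, ⟨1, o, ε⟩], [⟨1, !o, ε⟩], [⟨2, !p, δ⟩]] := by
    refine hv.congr fun i => ?_
    fin_cases i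
    · exact List.Perm.swap _ _ _
    · rfl
    · rfl
  have h4 := LocEq.rename hE hv hw h3 σ
  convert h4 using 1 <;> funext s <;> fin_cases s <;>
    simp [renameWords, Endpoint.rename, Endpoint.opposite, hσ1, hσ2]

theorem isDiagram_pair (e : Endpoint) : IsDiagram ![[e, e.opposite]] := by
  apply IsClosed.isDiagram
  obtain ⟨c, o, ε⟩ := e
  cases o <;> simp [IsClosed, Endpoint.opposite]

theorem isDiagram_triple {e f : Endpoint} (hef : e.chord ≠ f.chord) :
    IsDiagram ![[e, f], [e.opposite], [f.opposite]] := by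
  apply IsClosed.isDiagram
  obtain ⟨c, o, ε⟩ := e
  obtain ⟨d, p, δ⟩ := f
  have h1 : c ≠ d := hef
  have h2 := h1.symm
  cases o <;> cases p <;>
    simp [IsClosed, Fin.forall_fin_succ, Fin.exists_fin_succ, Endpoint.opposite, h1, h2]

/-- The context cut out of the family of words `W` by replacing endpoints according to `h`. -/
def cut (W : Fin n → List Endpoint) (h : Endpoint → List (Endpoint ⊕ Fin k)) : Context n k :=
  fun i => (W i).flatMap h

theorem cut_valid {W : Fin n → List Endpoint} (hW : IsDiagram W)
    {h : Endpoint → List (Endpoint ⊕ Fin k)} (r : Fin k → Endpoint)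
    (hr : ∀ s, ∃ i, r s ∈ W i)
    (hh : ∀ s x, (h x).count (Sum.inr s) = if x = r s then 1 else 0) : (cut W h).Valid := by
  intro s
  rw [← hW.mult_eq_one (hr s)]
  refine Finset.sum_congr rfl fun i _ => ?_
  unfold cut
  induction W i with
  | nil => rfl
  | cons x l ih =>
    rw [List.flatMap_cons, List.count_append, ih, hh, List.count_cons, add_comm]
    simp

theorem cut_fill (W : Fin n → List Endpoint) (h : Endpoint → List (Endpoint ⊕ Fin k))
    (v : Fin k → List Endpoint) (i : Fin n) :
    (cut W h).fill v i = (W i).flatMap fun x => (h x).flatMap (Sum.elim (fun e => [e]) v) := by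
  simp only [cut, Context.fill, List.flatMap_assoc]

theorem flatMap_eq_self {l : List Endpoint} {h : Endpoint → List Endpoint}
    (hl : ∀ x ∈ l, h x = [x]) : l.flatMap h = l := by
  induction l with
  | nil => rfl
  | cons x l ih =>
    rw [List.flatMap_cons, hl x (by simp), ih fun y hy => hl y (by simp [hy])]
    rfl

/-- Replacing two adjacent endpoints of a circle and keeping the others. -/
theorem flatMap_update {W : Fin n → List Endpoint} (hW : IsDiagram W) {i : Fin n}
    {l r : List Endpoint} {e f : Endpoint} (hi : W i = l ++ e :: f :: r)
    {h : Endpoint → List Endpoint} (hh : ∀ x, x ≠ e → x ≠ f → h x = [x]) (z : List Endpoint)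
    (hz : h e ++ h f = z) :
    (fun j => (W j).flatMap h) = Function.update W i (l ++ z ++ r) := by
  obtain ⟨D, rfl⟩ := hW
  have hd := D.nodup i
  rw [hi] at hd
  funext j
  by_cases hj : j = i
  · subst hj
    rw [Function.update_self, hi, List.flatMap_append, List.flatMap_cons, List.flatMap_cons,
      flatMap_eq_self, flatMap_eq_self, ← List.append_assoc (h e), hz, List.append_assoc]
    · intro x hx
      refine hh x ?_ ?_ <;> rintro rfl <;> simp [List.nodup_append, hx] at hd
    · intro x hx
      refine hh x ?_ ?_ <;> rintro rfl <;> simp [List.nodup_append] at hd <;> grind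
  · rw [Function.update_of_ne hj]
    refine flatMap_eq_self fun x hx => hh x ?_ ?_ <;> rintro rfl
    · exact D.disjoint j i hj hx (by rw [hi]; simp)
    · exact D.disjoint j i hj hx (by rw [hi]; simp)

theorem Apart.congr_right {W : Fin n → List Endpoint} {v w : Fin k → List Endpoint}
    (h : Apart W v) (hvw : ∀ i, (v i).Perm (w i)) : Apart W w :=
  fun i e he j f hf => h i e he j f ((hvw j).mem_iff.2 hf)

/-- If chords can be split, then adjacent endpoints can be exchanged. -/
theorem rel_swap (hE : reidemeisterSetoid n ≤ E)
    (hS : ∀ o ε o₁ ε₁ o₂ ε₂, Splits E o ε o₁ ε₁ o₂ ε₂)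
    {W : Fin n → List Endpoint} (hW : IsDiagram W) {i : Fin n}
    {l r : List Endpoint} {e f : Endpoint} (hi : W i = l ++ e :: f :: r) :
    Rel E W (Function.update W i (l ++ f :: e :: r)) := by
  have he : ∃ j, e ∈ W j := ⟨i, by rw [hi]; simp⟩
  have hf : ∃ j, f ∈ W j := ⟨i, by rw [hi]; simp⟩
  have hopp : ∀ x, (∃ j, x ∈ W j) → ∃ j, x.opposite ∈ W j := by
    intro x hx
    rw [← mult_pos] at hx ⊢
    rwa [hW.mult_opposite]
  have hne : e ≠ f := by
    rintro rfl
    have := hW.mult_eq_one he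
    have h := Finset.single_le_sum (f := fun i => (W i).count e) (fun _ _ => Nat.zero_le _)
      (Finset.mem_univ i)
    simp only [hi, List.count_append, List.count_cons_self] at h
    unfold mult at this
    omega
  have hself : Function.update W i (l ++ [e, f] ++ r) = W := by
    rw [List.append_assoc, List.cons_append, List.cons_append, List.nil_append, ← hi,
      Function.update_eq_self]
  by_cases hc : e.chord = f.chord
  · have hf' : f = e.opposite := by
      have := (isDiagram_iff.1 hW).2.2 e f (mult_pos.2 he) (mult_pos.2 hf) hc
      rcases Endpoint.eq_or_eq_opposite hc this with h | h
      · exact absurd h hne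
      · rw [h, Endpoint.opposite_opposite]
    subst hf'
    let h : Endpoint → List (Endpoint ⊕ Fin 1) := fun x =>
      if x = e then [Sum.inr 0] else if x = e.opposite then [] else [Sum.inl x]
    have hfill : ∀ z, (cut W h).fill ![z] = Function.update W i (l ++ z ++ r) := by
      intro z
      rw [← flatMap_update hW hi
        (h := fun x => (h x).flatMap (Sum.elim (fun e => [e]) ![z])) ?_ z ?_]
      · funext j
        rw [cut_fill]
      · intro x h1 h2
        simp [h, h1, h2]
      · simp [h, Endpoint.opposite_ne]
    have hC : (cut W h).Valid := by
      refine cut_valid hW ![e] (fun s => by fin_cases s; exact he) fun s x => ?_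
      fin_cases s
      simp only [h]
      split_ifs <;> simp_all
    have key := (LocEq.swap_of_same_chord hE e).apply_of_isDiagram hC
      (isDiagram_pair e) (by rw [hfill, hself]; exact hW)
    rw [hfill, hfill, hself] at key
    have := key (Apart.congr_right ((hC.isDiagram_fill (isDiagram_pair e)).1
      (by rw [hfill, hself]; exact hW)).2 fun s => by fin_cases s; exact List.Perm.swap _ _ _)
    simpa using this
  · let h : Endpoint → List (Endpoint ⊕ Fin 3) := fun x =>
      if x = e then [Sum.inr 0] else if x = f then [] else
        if x = e.opposite then [Sum.inr 1] else if x = f.opposite then [Sum.inr 2] else [Sum.inl x]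
    have h1 : e ≠ f.opposite := fun h => hc (Endpoint.ext_iff.1 h).1
    have h2 : f ≠ e.opposite := fun h => hc (Endpoint.ext_iff.1 h).1.symm
    have h3 : e.opposite ≠ f.opposite := fun h => hc (Endpoint.ext_iff.1 h).1
    have hfill : ∀ z, (cut W h).fill ![z, [e.opposite], [f.opposite]] =
        Function.update W i (l ++ z ++ r) := by
      intro z
      rw [← flatMap_update hW hi (h := fun x => (h x).flatMap
        (Sum.elim (fun e => [e]) ![z, [e.opposite], [f.opposite]])) ?_ z ?_]
      · funext j
        rw [cut_fill]
      · intro x h1 h2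
        simp only [h, h1, h2, if_false]
        split_ifs <;> simp_all
      · simp [h, hne.symm]
    have hC : (cut W h).Valid := by
      refine cut_valid hW ![e, e.opposite, f.opposite] (fun s => ?_) fun s x => ?_
      · fin_cases s
        · exact he
        · exact hopp e he
        · exact hopp f hf
      · have h4 := Endpoint.opposite_ne e
        have h5 := Endpoint.opposite_ne f
        by_cases g1 : x = e
        · subst g1
          fin_cases s <;> simp [h, h4.symm, h1]
        by_cases g2 : x = f
        · subst g2
          fin_cases s <;> simp [h, h5.symm, h2, hne.symm]
        by_cases g3 : x = e.opposite
        · subst g3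
          fin_cases s <;> simp [h, h4, h3, h2.symm]
        by_cases g4 : x = f.opposite
        · subst g4
          fin_cases s <;> simp [h, h1.symm, h3.symm, h5]
        fin_cases s <;> simp [h, g1, g2, g3, g4]
    have hv := isDiagram_triple hc
    have hd : IsDiagram ((cut W h).fill ![[e, f], [e.opposite], [f.opposite]]) := by
      rw [hfill, hself]
      exact hW
    have key := (LocEq.swap_of_splits hE hS hc).apply_of_isDiagram hC hv hd
      (Apart.congr_right ((hC.isDiagram_fill hv).1 hd).2 fun s => by
        fin_cases s
        · exact List.Perm.swap _ _ _
        · rfl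
        · rfl)
    rw [hfill, hfill, hself] at key
    simpa using key

/-- The prefix `p` is arbitrary so that the induction on permutations can absorb a common head into
it. -/
theorem rel_update_perm (hE : reidemeisterSetoid n ≤ E)
    (hS : ∀ o ε o₁ ε₁ o₂ ε₂, Splits E o ε o₁ ε₁ o₂ ε₂) (i : Fin n) {a b : List Endpoint}
    (hab : a.Perm b) : ∀ (W : Fin n → List Endpoint) (p : List Endpoint), IsDiagram W →
      W i = p ++ a → Rel E W (Function.update W i (p ++ b)) := by
  induction hab with
  | nil =>
    intro W p hW hi
    rw [← hi, Function.update_eq_self]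
    exact Rel.refl hW
  | cons x _ ih =>
    intro W p hW hi
    have := ih W (p ++ [x]) hW (by rw [hi]; simp)
    simpa using this
  | swap x y l =>
    intro W p hW hi
    exact rel_swap hE hS hW hi
  | trans _ _ ih1 ih2 =>
    intro W p hW hi
    have h1 := ih1 W p hW hi
    have h2 := ih2 _ p h1.right (Function.update_self _ _ _)
    rw [Function.update_idem] at h2
    exact h1.trans h2

/-- If chords can be split, then the order of the endpoints on each circle does not matter. -/
theorem rel_of_perm (hE : reidemeisterSetoid n ≤ E)
    (hS : ∀ o ε o₁ ε₁ o₂ ε₂, Splits E o ε o₁ ε₁ o₂ ε₂)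
    {W W' : Fin n → List Endpoint} (hW : IsDiagram W) (h : ∀ i, (W i).Perm (W' i)) :
    Rel E W W' := by
  -- The circles are rearranged one at a time; `s` is the set of those already done.
  have key : ∀ s : Finset (Fin n), Rel E W (s.piecewise W' W) := by
    intro s
    induction s using Finset.induction_on with
    | empty => simpa using Rel.refl hW
    | insert i s hi ih =>
      rw [Finset.piecewise_insert]
      exact ih.trans (rel_update_perm hE hS i (h i) _ [] ih.right
        (by rw [Finset.piecewise_eq_of_notMem _ _ _ hi, List.nil_append]))
  simpa using key Finset.univ

/-! ### Diagrams as lists of typed chords. -/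

/-- The initial circle, the terminal circle and the sign of a chord. -/
abbrev ChordType (n : ℕ) : Type := Fin n × Fin n × ℤˣ

/-- The endpoints of a chord with a name and a type that lie on the circle `j`. -/
def chordEnds (t : ℕ × ChordType n) (j : Fin n) : List Endpoint :=
  (if t.2.1 = j then [overEnd t.1 t.2.2.2] else []) ++
    if t.2.2.1 = j then [underEnd t.1 t.2.2.2] else []

/-- The circles of a diagram with given chords, in a standard order. -/
def ofChords (L : List (ℕ × ChordType n)) (j : Fin n) : List Endpoint :=
  L.flatMap fun t => chordEnds t j

theorem ofChords_cons (t : ℕ × ChordType n) (L : List (ℕ × ChordType n)) (j : Fin n) :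
    ofChords (t :: L) j = chordEnds t j ++ ofChords L j := List.flatMap_cons

theorem sum_count_chordEnds (t : ℕ × ChordType n) (e : Endpoint) :
    ∑ j, (chordEnds t j).count e = if t.1 = e.chord ∧ t.2.2.2 = e.sign then 1 else 0 := by
  have h : ∀ (i : Fin n) (f : Endpoint), ∑ j, (if i = j then [f] else []).count e =
      if f = e then 1 else 0 := by
    intro i f
    rw [Finset.sum_eq_single i]
    · simp [List.count_singleton]
    · intro j _ hj
      simp [Ne.symm hj]
    · simp
  simp only [chordEnds, List.count_append, Finset.sum_add_distrib, h]
  obtain ⟨c, o, ε⟩ := e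
  cases o <;> simp [overEnd, underEnd]

/-- The count does not involve `isOver`, so opposite endpoints have equal multiplicities. -/
theorem mult_ofChords (L : List (ℕ × ChordType n)) (e : Endpoint) :
    mult (ofChords L) e = L.countP fun t => t.1 = e.chord ∧ t.2.2.2 = e.sign := by
  induction L with
  | nil => simp [mult, ofChords]
  | cons t L ih =>
    rw [List.countP_cons, ← ih, add_comm]
    simp only [mult, ofChords_cons, List.count_append, Finset.sum_add_distrib,
      sum_count_chordEnds, decide_eq_true_eq]

theorem eq_of_nodup_names {L : List (ℕ × ChordType n)} (hL : (L.map Prod.fst).Nodup)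
    {s t : ℕ × ChordType n} (hs : s ∈ L) (ht : t ∈ L) (h : s.1 = t.1) : s = t :=
  List.inj_on_of_nodup_map hL hs ht h

theorem isDiagram_ofChords {L : List (ℕ × ChordType n)} (hL : (L.map Prod.fst).Nodup) :
    IsDiagram (ofChords L) := by
  rw [isDiagram_iff]
  simp only [mult_ofChords]
  refine ⟨fun e => ?_, fun e => le_rfl, fun e f he hf hc => ?_⟩
  · refine le_trans ?_ (List.nodup_iff_count_le_one.1 hL e.chord)
    rw [List.count, List.countP_map]
    exact List.countP_mono_left fun t _ ht => by simp_all
  · obtain ⟨s, hs, hs'⟩ := List.countP_pos_iff.1 he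
    obtain ⟨t, ht, ht'⟩ := List.countP_pos_iff.1 hf
    simp only [decide_eq_true_eq] at hs' ht'
    have := eq_of_nodup_names hL hs ht (by rw [hs'.1, ht'.1, hc])
    rw [← hs'.2, ← ht'.2, this]

theorem ofChords_perm {L L' : List (ℕ × ChordType n)} (h : L.Perm L') (j : Fin n) :
    (ofChords L j).Perm (ofChords L' j) := h.flatMap_right _

/-- Every Gauss diagram has the chords of a list, up to the order of the endpoints. -/
theorem exists_ofChords (D : GaussDiagram n) :
    ∃ L : List (ℕ × ChordType n), (L.map Prod.fst).Nodup ∧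
      ∀ j, (D.circle j).Perm (ofChords L j) := by
  rcases Nat.eq_zero_or_pos n with rfl | hn
  · exact ⟨[], List.nodup_nil, fun j => j.elim0⟩
  have hloc : ∃ loc : Endpoint → Fin n, ∀ i, ∀ e ∈ D.circle i, loc e = i := by
    classical
    -- The default circle for endpoints outside `D` is immaterial, but it needs `0 < n`.
    refine ⟨fun e => if h : ∃ i, e ∈ D.circle i then h.choose else ⟨0, hn⟩, fun i e he => ?_⟩
    have h : ∃ i, e ∈ D.circle i := ⟨i, he⟩
    simp only [dif_pos h]
    by_contra hne
    exact D.disjoint _ _ hne h.choose_spec he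
  obtain ⟨loc, hloc⟩ := hloc
  -- Each chord is represented by its initial endpoint.
  let A : Finset Endpoint := (Finset.univ.biUnion fun i => (D.circle i).toFinset).filter
    fun e => e.isOver = true
  have hA : ∀ e, e ∈ A ↔ (∃ i, e ∈ D.circle i) ∧ e.isOver = true := by simp [A]
  have hnd : ((A.toList.map fun e => (e.chord, loc e, loc e.opposite, e.sign)).map
      Prod.fst).Nodup := by
    rw [List.map_map]
    refine A.nodup_toList.map_on fun e he f hf hef => ?_
    rw [Finset.mem_toList, hA] at he hf
    obtain ⟨⟨i, hi⟩, heo⟩ := he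
    obtain ⟨⟨j, hj⟩, hfo⟩ := hf
    exact Endpoint.ext hef (heo.trans hfo.symm) (D.sign_eq i j e hi f hj hef)
  refine ⟨_, hnd, fun j => ?_⟩
  have hnd' : (ofChords (A.toList.map fun e => (e.chord, loc e, loc e.opposite, e.sign)) j).Nodup := by
    obtain ⟨D', hD'⟩ := isDiagram_ofChords hnd
    rw [← hD']
    exact D'.nodup j
  rw [List.perm_ext_iff_of_nodup (D.nodup j) hnd']
  intro e
  simp only [ofChords, List.mem_flatMap, List.mem_map, Finset.mem_toList, hA, chordEnds,
    List.mem_append, List.mem_ite_nil_right, List.mem_singleton]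
  constructor
  · intro he
    obtain ⟨i, hi⟩ := D.opposite_mem j e he
    by_cases ho : e.isOver = true
    · exact ⟨_, ⟨e, ⟨⟨j, he⟩, ho⟩, rfl⟩, Or.inl ⟨hloc j e he, Endpoint.ext rfl ho rfl⟩⟩
    · refine ⟨_, ⟨e.opposite, ⟨⟨i, hi⟩, by simpa [Endpoint.opposite] using ho⟩, rfl⟩, Or.inr ⟨?_, ?_⟩⟩
      · rw [Endpoint.opposite_opposite]
        exact hloc j e he
      · exact Endpoint.ext rfl (by simpa [underEnd] using ho) rfl
  · rintro ⟨_, ⟨f, ⟨⟨i, hi⟩, ho⟩, rfl⟩, ⟨h1, rfl⟩ | ⟨h1, rfl⟩⟩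
    · simp only at h1
      rw [hloc i f hi] at h1
      subst h1
      convert hi
      exact Endpoint.ext rfl ho.symm rfl
    · obtain ⟨l, hl⟩ := D.opposite_mem i f hi
      simp only at h1
      rw [hloc l _ hl] at h1
      subst h1
      convert hl
      exact Endpoint.ext rfl (by simp [underEnd, Endpoint.opposite, ho]) rfl

/-- Diagrams with the same chords up to names are in the same class. -/
theorem rel_of_map_snd_perm (hE : reidemeisterSetoid n ≤ E)
    (hS : ∀ o ε o₁ ε₁ o₂ ε₂, Splits E o ε o₁ ε₁ o₂ ε₂)
    {L L' : List (ℕ × ChordType n)} (hL : (L.map Prod.fst).Nodup) (hL' : (L'.map Prod.fst).Nodup)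
    (h : (L.map Prod.snd).Perm (L'.map Prod.snd)) : Rel E (ofChords L) (ofChords L') := by
  -- `L₁` rearranges `L'` so that its types match those of `L` position by position; only the names
  -- then differ.
  obtain ⟨L₁, h1, h2⟩ : ∃ L₁ : List (ℕ × ChordType n),
      List.Forall₂ (fun t x => t = x.2) (L.map Prod.snd) L₁ ∧ L₁.Perm L' := by
    have h3 : List.Forall₂ (fun (t : ChordType n) (x : ℕ × ChordType n) => t = x.2)
        (L'.map Prod.snd) L' := by
      rw [List.forall₂_map_left_iff]
      exact List.forall₂_same.2 fun _ _ => rfl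
    have h4 : Relation.Comp List.Perm (List.Forall₂ fun (t : ChordType n) x => t = x.2)
        (L.map Prod.snd) L' := ⟨_, h, h3⟩
    rwa [← List.forall₂_comp_perm_eq_perm_comp_forall₂] at h4
  have hL₁ : (L₁.map Prod.fst).Nodup := (h2.map _).nodup_iff.2 hL'
  have hσ : ∃ σ : Equiv.Perm ℕ, L₁ = L.map fun t => (σ t.1, t.2) := by
    rw [List.forall₂_map_left_iff] at h1
    have hf : ∃ f : ℕ → ℕ, L₁ = L.map fun t => (f t.1, t.2) := by
      clear h h2
      induction h1 with
      | nil => exact ⟨id, rfl⟩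
      | @cons t x l l₁ htx _ ih =>
        simp only [List.map_cons, List.nodup_cons] at hL hL₁
        obtain ⟨f, hf⟩ := ih hL.2 hL₁.2
        refine ⟨Function.update f t.1 x.1, ?_⟩
        rw [List.map_cons, Function.update_self, htx, hf]
        refine congrArg (_ :: ·) (List.map_congr_left fun y hy => ?_)
        rw [Function.update_of_ne]
        intro h
        exact hL.1 (h ▸ List.mem_map_of_mem hy)
    obtain ⟨f, hf⟩ := hf
    obtain ⟨σ, hσ⟩ := exists_perm_eqOn (L.map Prod.fst).toFinset f (by
      intro x hx y hy hxy
      simp only [List.coe_toFinset, Set.mem_ofPred_eq, List.mem_map] at hx hy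
      obtain ⟨s, hs, rfl⟩ := hx
      obtain ⟨t, ht, rfl⟩ := hy
      have h3 : (L.map fun t => f t.1).Nodup := by
        have : L.map (fun t => f t.1) = L₁.map Prod.fst := by rw [hf, List.map_map]; rfl
        rwa [this]
      exact congrArg Prod.fst (List.inj_on_of_nodup_map h3 hs ht hxy))
    refine ⟨σ, hf.trans (List.map_congr_left fun t ht => ?_)⟩
    rw [hσ _ (by simpa using ⟨_, _, _, ht⟩)]
  obtain ⟨σ, rfl⟩ := hσ
  have h3 : renameWords σ (ofChords L) = ofChords (L.map fun t => (σ t.1, t.2)) := by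
    funext j
    simp only [renameWords, ofChords, List.map_flatMap, List.flatMap_map]
    refine congrArg (fun f => List.flatMap f L) ?_
    funext t
    simp only [chordEnds, List.map_append, apply_ite (List.map (Endpoint.rename σ)), List.map_cons,
      List.map_nil]
    rfl
  have h4 := rel_renameWords hE (isDiagram_ofChords hL) σ
  rw [h3] at h4
  exact h4.trans (rel_of_perm hE hS (isDiagram_ofChords hL₁) (ofChords_perm h2))

/-- Insert `k` arcs into the diagram with given chords, the `s`-th one on the circle `a s`. -/
def arcs (a : Fin k → Fin n) (U : List (ℕ × ChordType n)) : Context n k := fun j =>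
  ((List.finRange k).flatMap fun s => if a s = j then [Sum.inr s] else []) ++
    (ofChords U j).map Sum.inl

theorem arcs_fill (a : Fin k → Fin n) (U : List (ℕ × ChordType n)) (v : Fin k → List Endpoint)
    (j : Fin n) : (arcs a U).fill v j =
      ((List.finRange k).flatMap fun s => if a s = j then v s else []) ++ ofChords U j := by
  simp only [Context.fill, arcs, List.flatMap_append, List.flatMap_assoc, List.flatMap_map,
    Sum.elim_inl]
  congr 1
  · refine congrArg (fun f => List.flatMap f (List.finRange k)) ?_
    funext s
    split_ifs <;> simp
  · exact flatMap_eq_self fun _ _ => rfl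

theorem arcs_valid (a : Fin k → Fin n) (U : List (ℕ × ChordType n)) : (arcs a U).Valid := by
  intro s
  have h : ∀ j, (arcs a U j).count (Sum.inr s) = if a s = j then 1 else 0 := by
    intro j
    have h1 : ((ofChords U j).map (Sum.inl : _ → Endpoint ⊕ Fin k)).count (Sum.inr s) = 0 :=
      List.count_eq_zero_of_not_mem (by simp)
    have h2 : ∀ t, (if a t = j then [(Sum.inr t : Endpoint ⊕ Fin k)] else []).count (Sum.inr s) =
        if s = t then (if a s = j then 1 else 0) else 0 := by
      intro t
      by_cases hst : s = t
      · subst hst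
        rw [if_pos rfl]
        split_ifs <;> simp
      · have : t ≠ s := Ne.symm hst
        split_ifs <;> simp [this]
    rw [arcs, List.count_append, h1, add_zero, List.count_flatMap]
    simp only [Function.comp_def, h2]
    rw [← List.ofFn_eq_map, List.sum_ofFn]
    simp
  simp [h]

/-- Because order is immaterial, the endpoints to be exchanged can be gathered into arcs at the
front of the circles. -/
theorem rel_of_locEq (hE : reidemeisterSetoid n ≤ E)
    (hS : ∀ o ε o₁ ε₁ o₂ ε₂, Splits E o ε o₁ ε₁ o₂ ε₂) {v w : Fin k → List Endpoint}
    (h : LocEq E v w) (hv : IsDiagram v) (hw : IsDiagram w) (a : Fin k → Fin n)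
    {L L' U : List (ℕ × ChordType n)} (hL : (L.map Prod.fst).Nodup)
    (hL' : (L'.map Prod.fst).Nodup)
    (hLv : ∀ j, (ofChords L j).Perm ((arcs a U).fill v j))
    (hLw : ∀ j, (ofChords L' j).Perm ((arcs a U).fill w j)) :
    Rel E (ofChords L) (ofChords L') := by
  have h1 := rel_of_perm hE hS (isDiagram_ofChords hL) hLv
  have h2 := rel_of_perm hE hS (isDiagram_ofChords hL') hLw
  have hC := arcs_valid a U
  obtain ⟨h3, h4⟩ := (hC.isDiagram_fill hv).1 h1.right
  exact (h1.trans (h _ hC h3 h4 ((hC.isDiagram_fill hw).1 h2.right).2)).trans h2.symm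

theorem rel_self_chord (hE : reidemeisterSetoid n ≤ E)
    (hS : ∀ o ε o₁ ε₁ o₂ ε₂, Splits E o ε o₁ ε₁ o₂ ε₂) {c : ℕ} {i : Fin n} {ε : ℤˣ}
    {U : List (ℕ × ChordType n)} (hU : (((c, i, i, ε) :: U).map Prod.fst).Nodup) :
    Rel E (ofChords ((c, i, i, ε) :: U)) (ofChords U) := by
  refine rel_of_locEq hE hS (LocEq.one hE c true ε) (isDiagram_pair ⟨c, true, ε⟩)
    (IsClosed.isDiagram (by decide)) ![i] (U := U) hU hU.of_cons (fun j => ?_) fun j => ?_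
  · rw [arcs_fill, ofChords_cons, chordEnds]
    by_cases h : i = j <;> simp [h, List.finRange_succ, overEnd, underEnd]
  · rw [arcs_fill]
    simp [List.finRange_succ]

/-- The chord is split with its new place on circle `z`. The names `0`, `1`, `2` are those used in
`Splits`, so the other names start at `3`. -/
theorem rel_hub (hE : reidemeisterSetoid n ≤ E)
    (hS : ∀ o ε o₁ ε₁ o₂ ε₂, Splits E o ε o₁ ε₁ o₂ ε₂) (i j z : Fin n) {ε : ℤˣ}
    {U : List (ℕ × ChordType n)} (hU : (U.map Prod.fst).Nodup) (h3 : ∀ t ∈ U, 3 ≤ t.1) :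
    Rel E (ofChords ((0, i, j, ε) :: U)) (ofChords ((1, i, z, 1) :: (2, j, z, 1) :: U)) := by
  have hn : ∀ c < 3, c ∉ U.map Prod.fst := by
    intro c hc h
    obtain ⟨t, ht, rfl⟩ := List.mem_map.1 h
    exact absurd (h3 t ht) (by omega)
  refine rel_of_locEq hE hS (hS true ε true 1 true 1) ?_ (IsClosed.isDiagram (by decide))
    ![i, j, z] (U := U) (List.nodup_cons.2 ⟨hn 0 (by norm_num), hU⟩) ?_ (fun l => ?_) fun l => ?_
  · apply IsClosed.isDiagram
    rcases Int.units_eq_one_or ε with rfl | rfl <;> decide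
  · simp only [List.map_cons, List.nodup_cons, List.mem_cons, not_or]
    exact ⟨⟨by norm_num, hn 1 (by norm_num)⟩, hn 2 (by norm_num), hU⟩
  · rw [arcs_fill, ofChords_cons, chordEnds]
    by_cases h1 : i = l <;> by_cases h2 : j = l <;> by_cases h : z = l <;>
      simp [List.finRange_succ, overEnd, underEnd, h1, h2, h]
  · rw [arcs_fill, ofChords_cons, ofChords_cons, chordEnds, chordEnds, ← List.append_assoc]
    refine List.Perm.append_right _ ?_
    rw [List.perm_iff_count]
    intro e
    by_cases h1 : i = l <;> by_cases h2 : j = l <;> by_cases h3 : z = l <;>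
      simp [List.finRange_succ, overEnd, underEnd, h1, h2, h3, List.count_cons] <;> omega

/-! ### The commutative monoid of chord types. -/

theorem exists_names (u : Multiset (ChordType n)) (N : ℕ) :
    ∃ U : List (ℕ × ChordType n), (U.map Prod.fst).Nodup ∧ (∀ t ∈ U, N ≤ t.1) ∧
      (U.map Prod.snd : Multiset (ChordType n)) = u := by
  refine ⟨(List.range' N u.toList.length).zip u.toList, ?_, fun t ht => ?_, ?_⟩
  · rw [List.map_fst_zip (by simp)]
    exact List.nodup_range'
  · have := (List.of_mem_zip (show (t.1, t.2) ∈ _ from ht)).1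
    simp only [List.mem_range'_1] at this
    exact this.1
  · rw [List.map_snd_zip (by simp), Multiset.coe_toList]

/-- Diagrams whose chords have the types in `u` and `u'` are in the same class. -/
def SameClass (E : Setoid (GaussDiagram n)) (u u' : Multiset (ChordType n)) : Prop :=
  ∀ L L' : List (ℕ × ChordType n), (L.map Prod.fst).Nodup → (L'.map Prod.fst).Nodup →
    (L.map Prod.snd : Multiset (ChordType n)) = u →
      (L'.map Prod.snd : Multiset (ChordType n)) = u' → Rel E (ofChords L) (ofChords L')

theorem SameClass.trans {u u' u'' : Multiset (ChordType n)} (h : SameClass E u u')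
    (h' : SameClass E u' u'') : SameClass E u u'' := by
  intro L L' hL hL' hu hu'
  obtain ⟨U, hU, -, hU'⟩ := exists_names u' 0
  exact (h L U hL hU hu hU').trans (h' U L' hU hL' hU' hu')

theorem SameClass.of_rel (hE : reidemeisterSetoid n ≤ E)
    (hS : ∀ o ε o₁ ε₁ o₂ ε₂, Splits E o ε o₁ ε₁ o₂ ε₂) {L L' : List (ℕ × ChordType n)}
    (hL : (L.map Prod.fst).Nodup) (hL' : (L'.map Prod.fst).Nodup)
    (h : Rel E (ofChords L) (ofChords L')) :
    SameClass E (L.map Prod.snd : Multiset (ChordType n)) (L'.map Prod.snd) := by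
  intro M M' hM hM' h1 h2
  exact ((rel_of_map_snd_perm hE hS hM hL (Multiset.coe_eq_coe.1 h1)).trans h).trans
    (rel_of_map_snd_perm hE hS hL' hM' (Multiset.coe_eq_coe.1 h2.symm))

/-- Multisets of types of chords which may be exchanged in every diagram. -/
def chordCon (hE : reidemeisterSetoid n ≤ E)
    (hS : ∀ o ε o₁ ε₁ o₂ ε₂, Splits E o ε o₁ ε₁ o₂ ε₂) : AddCon (Multiset (ChordType n)) where
  -- Allowing any remaining chords `u` makes the relation compatible with addition.
  r a b := ∀ u, SameClass E (a + u) (b + u)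
  iseqv :=
    { refl := fun _ _ _ _ hL hL' h h' => rel_of_map_snd_perm hE hS hL hL'
        (Multiset.coe_eq_coe.1 (h.trans h'.symm))
      symm := fun h u L L' hL hL' hu hu' => (h u L' L hL' hL hu' hu).symm
      trans := fun h h' u => (h u).trans (h' u) }
  add' := by
    intro a b c d hab hcd u
    have h1 := hab (c + u)
    have h2 := hcd (b + u)
    rw [← add_assoc, ← add_assoc] at h1
    rw [← add_assoc, ← add_assoc, add_comm c, add_comm d] at h2
    exact h1.trans h2

section

variable (hE : reidemeisterSetoid n ≤ E) (hS : ∀ o ε o₁ ε₁ o₂ ε₂, Splits E o ε o₁ ε₁ o₂ ε₂)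

/-- The class of a chord of a given type. -/
def chordClass (t : ChordType n) : (chordCon hE hS).Quotient :=
  (chordCon hE hS).mk' {t}

theorem chordClass_self (i : Fin n) (ε : ℤˣ) : chordClass hE hS (i, i, ε) = 0 := by
  rw [← map_zero (chordCon hE hS).mk']
  refine (AddCon.eq _).2 fun u => ?_
  obtain ⟨U, hU, h1, rfl⟩ := exists_names u 1
  have h : (((0, i, i, ε) :: U).map Prod.fst).Nodup := by
    refine List.nodup_cons.2 ⟨fun h => ?_, hU⟩
    obtain ⟨t, ht, h0⟩ := List.mem_map.1 h
    have := h1 t ht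
    omega
  rw [zero_add]
  exact SameClass.of_rel hE hS h hU (rel_self_chord hE hS h)

theorem chordClass_hub (i j z : Fin n) (ε : ℤˣ) : chordClass hE hS (i, j, ε) =
    chordClass hE hS (i, z, 1) + chordClass hE hS (j, z, 1) := by
  unfold chordClass
  rw [← map_add]
  refine (AddCon.eq _).2 fun u => ?_
  obtain ⟨U, hU, h1, rfl⟩ := exists_names u 3
  have h := rel_hub hE hS i j z (ε := ε) hU h1
  have hn : ∀ c < 3, c ∉ U.map Prod.fst := by
    intro c hc h
    obtain ⟨t, ht, rfl⟩ := List.mem_map.1 h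
    exact absurd (h1 t ht) (by omega)
  refine SameClass.of_rel hE hS (L := (0, i, j, ε) :: U)
    (L' := (1, i, z, 1) :: (2, j, z, 1) :: U) (List.nodup_cons.2 ⟨hn 0 (by norm_num), hU⟩) ?_ h
  simp only [List.map_cons, List.nodup_cons, List.mem_cons, not_or]
  exact ⟨⟨by norm_num, hn 1 (by norm_num)⟩, hn 2 (by norm_num), hU⟩

/-- By `chordClass_hub`, each endpoint on circle `i` contributes one copy of the class of a chord
from `i` to the hub `z`. -/
theorem mk_eq_sum (z : Fin n) (L : List (ℕ × ChordType n)) :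
    (chordCon hE hS).mk' (L.map Prod.snd : Multiset (ChordType n)) =
      ∑ i, (ofChords L i).length • chordClass hE hS (i, z, 1) := by
  induction L with
  | nil => simp [ofChords]
  | cons t L ih =>
    obtain ⟨c, a, b, ε⟩ := t
    rw [List.map_cons, ← Multiset.cons_coe, ← Multiset.singleton_add, map_add, ih]
    simp only [ofChords_cons, List.length_append, add_smul, Finset.sum_add_distrib]
    congr 1
    refine (chordClass_hub hE hS a b z ε).trans ?_
    simp [chordEnds, add_smul, Finset.sum_add_distrib, apply_ite List.length, ite_smul]

end

/-- If chords can be split, then the parities determine the class of a Gauss diagram. -/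
theorem rel_of_parity (hE : reidemeisterSetoid n ≤ E)
    (hS : ∀ o ε o₁ ε₁ o₂ ε₂, Splits E o ε o₁ ε₁ o₂ ε₂) {D D' : GaussDiagram n}
    (h : ∀ i, D.parity i = D'.parity i) : E D D' := by
  obtain ⟨L, hL, h1⟩ := exists_ofChords D
  obtain ⟨L', hL', h2⟩ := exists_ofChords D'
  have hlen : ∀ i, (ofChords L i).length ≡ (ofChords L' i).length [MOD 2] := by
    intro i
    rw [← (h1 i).length_eq, ← (h2 i).length_eq, ← ZMod.natCast_eq_natCast_iff,
      ← parity_eq_length, ← parity_eq_length, h i]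
  have key : (chordCon hE hS).mk' (L.map Prod.snd : Multiset (ChordType n)) =
      (chordCon hE hS).mk' (L'.map Prod.snd : Multiset (ChordType n)) := by
    rcases Nat.eq_zero_or_pos n with rfl | hn
    · have : ∀ l : List (ℕ × ChordType 0), l = [] := fun l => by
        rcases l with _ | ⟨t, _⟩
        · rfl
        · exact t.2.1.elim0
      rw [this L, this L']
    · rw [mk_eq_sum hE hS ⟨0, hn⟩, mk_eq_sum hE hS ⟨0, hn⟩]
      refine Finset.sum_congr rfl fun i _ => ?_
      -- Two chords from `i` to the hub merge into a chord with both ends on `i`, which vanishes.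
      have h0 : 2 • chordClass hE hS (i, ⟨0, hn⟩, 1) = 0 := by
        rw [two_nsmul, ← chordClass_hub hE hS i i ⟨0, hn⟩ 1, chordClass_self]
      have hmod : ∀ a : ℕ, a • chordClass hE hS (i, ⟨0, hn⟩, 1) =
          (a % 2) • chordClass hE hS (i, ⟨0, hn⟩, 1) := by
        intro a
        conv_lhs => rw [← Nat.mod_add_div a 2, add_smul, mul_comm, mul_smul, h0, nsmul_zero, add_zero]
      rw [hmod, hlen i, ← hmod]
  have h3 := (AddCon.eq _).1 key 0 L L' hL hL' (add_zero _).symm (add_zero _).symm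
  have h4 := rel_of_perm hE hS ⟨D, rfl⟩ h1
  have h5 := rel_of_perm hE hS ⟨D', rfl⟩ h2
  exact ((h4.trans h3).trans h5.symm).apply

end GaussDiagram

/-! ### Passage to links and the equivalence. -/

open GaussDiagram

/-- Diagrams which present equivalent links. -/
def moveSetoid {n : ℕ} (X : GaussDiagram n → GaussDiagram n → Prop) : Setoid (GaussDiagram n) where
  r D D' := MoveEquivalent X D.toLink D'.toLink
  iseqv := ⟨fun _ => .refl _, fun h => .symm _ _ h, fun h h' => .trans _ _ _ h h'⟩

theorem reidemeisterSetoid_le_moveSetoid {n : ℕ} (X : GaussDiagram n → GaussDiagram n → Prop) :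
    reidemeisterSetoid n ≤ moveSetoid X := by
  intro D D' h
  have : D.toLink = D'.toLink := Quotient.sound h
  change MoveEquivalent X D.toLink D'.toLink
  rw [this]
  exact .refl _

theorem moveSetoid_of_move {n : ℕ} {X : GaussDiagram n → GaussDiagram n → Prop}
    (D D' : GaussDiagram n) (h : X D D') : moveSetoid X D D' :=
  .rel _ _ ⟨D, D', rfl, rfl, h⟩

theorem parity_eq_of_moveEquivalent {n : ℕ} {X : GaussDiagram n → GaussDiagram n → Prop}
    (hX : ∀ D D', X D D' → ∀ i, D.parity i = D'.parity i) {L L' : VirtualLink n}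
    (h : MoveEquivalent X L L') (i : Fin n) : L.parity i = L'.parity i := by
  induction h with
  | rel _ _ h =>
    obtain ⟨D, D', rfl, rfl, h⟩ := h
    exact hX D D' h i
  | refl => rfl
  | symm _ _ _ ih => exact ih.symm
  | trans _ _ _ _ _ ih ih' => exact ih.trans ih'

/-- Every strand of the triangle carries exactly two of the deleted endpoints. -/
theorem VDelta.parity_eq {n : ℕ} {D D' : GaussDiagram n} (h : VDelta D D') (i : Fin n) :
    D.parity i = D'.parity i := by
  obtain ⟨c, ε, s, h⟩ := h
  refine h.parity_eq (fun j => ?_) i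
  simp only [deltaCrossings, directed]
  split_ifs <;> simp <;> rfl

theorem VSharp.parity_eq {n : ℕ} {D D' : GaussDiagram n} (h : VSharp D D') (i : Fin n) :
    D.parity i = D'.parity i := by
  obtain ⟨c, ε, h⟩ := h
  refine h.parity_eq (fun j => ?_) i
  fin_cases j <;> simp [sharpCrossings] <;> rfl

theorem theorem1p1 (n : ℕ) (hn : 2 ≤ n) (L L' : VirtualLink n) :
    List.TFAE [
      MoveEquivalent VDelta L L',
      MoveEquivalent VDeltaWedge L L',
      MoveEquivalent VSharp L L',
      ∀ i : Fin n, L.parity i = L'.parity i] := by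
  tfae_have 2 → 1 := by
    refine Relation.EqvGen.mono (fun K K' => ?_) L L'
    rintro ⟨D, D', hD, hD', c, ε, s, -, h⟩
    exact ⟨D, D', hD, hD', c, ε, s, h⟩
  tfae_have 1 → 4 := parity_eq_of_moveEquivalent fun _ _ => VDelta.parity_eq
  tfae_have 3 → 4 := parity_eq_of_moveEquivalent fun _ _ => VSharp.parity_eq
  tfae_have 4 → 2 := by
    intro h
    induction L using Quotient.inductionOn with | _ D
    induction L' using Quotient.inductionOn with | _ D'
    -- On representatives, `moveSetoid` and `GaussDiagram.parity` unfold to the move equivalence and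
    -- the parities of the links.
    exact rel_of_parity (reidemeisterSetoid_le_moveSetoid VDeltaWedge)
      (splits_of_delta (reidemeisterSetoid_le_moveSetoid _) moveSetoid_of_move) h
  tfae_have 4 → 3 := by
    intro h
    induction L using Quotient.inductionOn with | _ D
    induction L' using Quotient.inductionOn with | _ D'
    exact rel_of_parity (reidemeisterSetoid_le_moveSetoid VSharp)
      (splits_of_sharp (reidemeisterSetoid_le_moveSetoid _) moveSetoid_of_move) h
  tfae_finish
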